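/- Let $k$ be a field and let $H$ be a pointed Hopf $k$-algebra with comultiplication $\Delta$, group of group-like elements $G(H)$, and antipode $S$. Let $H_0$ be the coradical of $H$ (the sum of its simple subcoalgebras; pointed means $H_0=kG(H)$) and let $H_n=\Delta^{-1}(H\otimes H_{n-1}+H_0\otimes H)$ for $n\ge 1$ be the coradical filtration. Let $\operatorname{gr}H=\bigoplus_{n\ge 0}H_n/H_{n-1}$ (with $H_{-1}=0$) be the associated graded Hopf algebra, with antipode $\overline S$. The order $|S|$ is the least $n\ge 1$ with $S^n=\mathrm{id}$, or $\infty$ if there is no such $n$; $|\overline S|$ is defined in the same way. For $x\in G(H)$ put $P_{x,1}(H)=\{h\in H:\Delta(h)=h\otimes x+1\otimes h\}$, and let $a_x=|\langle x\rangle:C_{\langle x\rangle}(P_{x,1}(H))|\in\{1,2,\dots\}\cup\{\infty\}$ be the index in $\langle x\rangle$ of the subgroup of those elements that act trivially on $P_{x,1}(H)$ by conjugation. Let $m_H=\operatorname{lcm}\{a_x:x\in G(H)\}$, that is, the least positive integer divisible by every $a_x$ if the $a_x$ are finite and such an integer exists, and $m_H=\infty$ otherwise. Define $m_{\operatorname{gr}H}$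 in the same way for the Hopf algebra $\operatorname{gr}H$. Then: 1. If $m_H=\infty$, then $|S|=\infty$. 2. If $m_H<\infty$, then $(S^{2m_H}-\mathrm{id})(H_n)\subseteq H_{n-1}$ for all $n\ge 1$. 3. Suppose $\operatorname{char}k=0$. If $|S|<\infty$, then either $S=\mathrm{id}$ or $|S|=2m_H=2m_{\operatorname{gr}H}=|\overline S|$. 4. Suppose $\operatorname{char}k=p>0$. If $m_H<\infty$ and $H$ is generated as an algebra by $H_n$ for some $n\ge 0$, then $|S|$ is finite and divides $2m_Hp^l$ for every integer $l\ge 0$ with $p^l\ge n$ (in particular for every integer $l\ge 0$ with $p^l\ge n\ge p^{l-1}$). -/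

import Mathlib

open scoped TensorProduct DirectSum
open Coalgebra

noncomputable section

namespace PointedHopf

section Coalg

variable (k : Type*) {C : Type*} [Field k] [AddCommGroup C] [Module k C]

variable {k} in
/-- The subspace `U ⊗ V` of `C ⊗ C`, for subspaces `U`, `V` of `C`. -/
def tensorSub (U V : Submodule k C) : Submodule k (C ⊗[k] C) :=
  LinearMap.range (TensorProduct.mapIncl U V)

variable {k} in
lemma tmul_mem_tensorSub {U V : Submodule k C} {a b : C} (ha : a ∈ U) (hb : b ∈ V) :
    a ⊗ₜ[k] b ∈ tensorSub U V :=
  ⟨(⟨a, ha⟩ : U) ⊗ₜ[k] (⟨b, hb⟩ : V), by simp [TensorProduct.mapIncl]⟩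

variable {k} in
lemma tensorSub_le {U V : Submodule k C} {P : Submodule k (C ⊗[k] C)}
    (h : ∀ a ∈ U, ∀ b ∈ V, a ⊗ₜ[k] b ∈ P) : tensorSub U V ≤ P := by
  rintro _ ⟨t, rfl⟩
  induction t with
  | zero => simp
  | tmul a b => simpa [TensorProduct.mapIncl] using h a a.2 b b.2
  | add x y hx hy => rw [map_add]; exact add_mem hx hy

variable {k} in
lemma tensorSub_mono {U U' V V' : Submodule k C} (hU : U ≤ U') (hV : V ≤ V') :
    tensorSub U V ≤ tensorSub U' V' :=
  tensorSub_le fun _ ha _ hb => tmul_mem_tensorSub (hU ha) (hV hb)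

variable {k} in
/-- Over a field, a subspace is the kernel of `1 - p` for some projection `p` onto it. -/
lemma exists_proj (U : Submodule k C) :
    ∃ p : C →ₗ[k] C, (∀ x, p x ∈ U) ∧ ∀ x ∈ U, p x = x := by
  obtain ⟨g, hg⟩ := LinearMap.exists_extend (LinearMap.id : U →ₗ[k] U)
  refine ⟨U.subtype ∘ₗ g, fun x => (g x).2, fun x hx => ?_⟩
  have := LinearMap.congr_fun hg ⟨x, hx⟩
  simpa using congrArg Subtype.val this

variable {k} in
/-- `(U ⊗ C) ∩ (C ⊗ V) = U ⊗ V`. -/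
lemma tensorSub_inf (U V : Submodule k C) :
    tensorSub U ⊤ ⊓ tensorSub ⊤ V ≤ tensorSub U V := by
  obtain ⟨p, hp, hp'⟩ := exists_proj U
  obtain ⟨q, hq, hq'⟩ := exists_proj V
  rintro t ⟨h1, h2⟩
  have e1 : tensorSub U ⊤ ≤ LinearMap.eqLocus (TensorProduct.map p LinearMap.id)
      (LinearMap.id : C ⊗[k] C →ₗ[k] C ⊗[k] C) :=
    tensorSub_le fun a ha b _ => by simp [hp' a ha]
  have e2 : tensorSub ⊤ V ≤ LinearMap.eqLocus (TensorProduct.map LinearMap.id q)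
      (LinearMap.id : C ⊗[k] C →ₗ[k] C ⊗[k] C) :=
    tensorSub_le fun a _ b hb => by simp [hq' b hb]
  have f1 : TensorProduct.map p LinearMap.id t = t := e1 h1
  have f2 : TensorProduct.map LinearMap.id q t = t := e2 h2
  have f3 : TensorProduct.map p q t = t := by
    conv_rhs => rw [← f1, ← f2]
    rw [← LinearMap.comp_apply, ← TensorProduct.map_comp]; simp
  rw [← f3]
  clear f1 f2 f3 h1 h2
  induction t with
  | zero => simp
  | tmul a b => simpa using tmul_mem_tensorSub (hp a) (hq b)
  | add x y hx hy => rw [map_add]; exact add_mem hx hy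

variable {k} in
lemma ker_map_mkQ (U V : Submodule k C) :
    LinearMap.ker (TensorProduct.map U.mkQ V.mkQ) = tensorSub ⊤ V ⊔ tensorSub U ⊤ := by
  apply le_antisymm
  · rw [TensorProduct.map_ker (f := U.subtype) (g := U.mkQ) (f' := V.subtype) (g' := V.mkQ)]
    · refine sup_le (le_sup_of_le_left ?_) (le_sup_of_le_right ?_)
      · rintro _ ⟨t, rfl⟩
        induction t with
        | zero => simp
        | tmul a b => simpa using tmul_mem_tensorSub (Submodule.mem_top) b.2
        | add x y hx hy => rw [map_add]; exact add_mem hx hy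
      · rintro _ ⟨t, rfl⟩
        induction t with
        | zero => simp
        | tmul a b => simpa using tmul_mem_tensorSub a.2 (Submodule.mem_top)
        | add x y hx hy => rw [map_add]; exact add_mem hx hy
    · intro x; simp
    · exact Submodule.mkQ_surjective _
    · intro x; simp
    · exact Submodule.mkQ_surjective _
  · refine sup_le (tensorSub_le fun a _ b hb => ?_) (tensorSub_le fun a ha b _ => ?_)
    · simp [(Submodule.Quotient.mk_eq_zero V).2 hb]
    · simp [(Submodule.Quotient.mk_eq_zero U).2 ha]

variable {k} in
lemma exists_factor {M : Type*} [AddCommGroup M] [Module k M] (f : C →ₗ[k] M)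
    (U : Submodule k C) (h : LinearMap.ker f = U) : ∃ g : M →ₗ[k] C ⧸ U, g ∘ₗ f = U.mkQ := by
  subst h
  obtain ⟨g, hg⟩ := LinearMap.exists_leftInverse_of_injective
    ((LinearMap.ker f).liftQ f le_rfl) (Submodule.ker_liftQ_eq_bot' _ _ rfl)
  refine ⟨g, LinearMap.ext fun x => ?_⟩
  exact LinearMap.congr_fun hg ((LinearMap.ker f).mkQ x)

variable {k} in
lemma sum_antidiagonal_comp {M N P : Type*} [AddCommGroup M] [Module k M] [AddCommGroup N]
    [Module k N] [AddCommGroup P] [Module k P] (f : ℕ → M →ₗ[k] N) (g : ℕ → C →ₗ[k] P)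
    (m j : ℕ) (x : M) (b : C) (hf : ∀ i', m < i' → f i' x = 0)
    (hg : ∀ j', j < j' → g j' b = 0) :
    ∑ ij ∈ Finset.HasAntidiagonal.antidiagonal (m + j), f ij.1 x ⊗ₜ[k] g ij.2 b =
      f m x ⊗ₜ[k] g j b := by
  rw [Finset.sum_eq_single (m, j)]
  · rintro ⟨i', j'⟩ h h'
    rw [Finset.HasAntidiagonal.mem_antidiagonal] at h
    simp only at h
    rcases lt_trichotomy i' m with h1 | h1 | h1
    · simp [hg j' (by omega)]
    · exact absurd (Prod.ext h1 (by simp only; omega)) h'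
    · simp [hf i' h1]
  · intro h
    exact absurd (Finset.HasAntidiagonal.mem_antidiagonal (a := (m, j)).2 rfl) h

variable [Coalgebra k C]

variable {k} in
/-- `D` is a subcoalgebra of `C`: `Δ(D) ⊆ D ⊗ D`. -/
def IsSubcoalgebra (D : Submodule k C) : Prop :=
  ∀ c ∈ D, comul (R := k) c ∈ tensorSub D D

variable {k} in
/-- `D` is a simple subcoalgebra of `C`: a nonzero subcoalgebra whose only subcoalgebras are
`0` and itself. -/
def IsSimpleSubcoalgebra (D : Submodule k C) : Prop :=
  IsSubcoalgebra D ∧ D ≠ ⊥ ∧ ∀ E : Submodule k C, IsSubcoalgebra E → E ≤ D → E = ⊥ ∨ E = D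

variable (C)

/-- The coradical of `C`: the sum of its simple subcoalgebras. -/
def coradical : Submodule k C := sSup {D | IsSimpleSubcoalgebra D}

/-- The coradical filtration: `C_0` is the coradical and
`C_{n+1} = Δ⁻¹(C ⊗ C_n + C_0 ⊗ C)`. -/
def coradFilt : ℕ → Submodule k C
  | 0 => coradical k C
  | n + 1 => (tensorSub ⊤ (coradFilt n) ⊔ tensorSub (coradical k C) ⊤).comap comul

/-- The preceding term of the coradical filtration, with the convention `C_{-1} = 0`. -/
def coradFiltPrev : ℕ → Submodule k C
  | 0 => ⊥
  | n + 1 => coradFilt k C n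

/-- `C` is pointed: its coradical is spanned by the group-like elements. -/
class IsPointed : Prop where
  coradical_eq : coradical k C = Submodule.span k {g : C | IsGroupLikeElem k g}

lemma isSubcoalgebra_coradical : IsSubcoalgebra (coradical k C) := by
  have : coradical k C ≤ (tensorSub (coradical k C) (coradical k C)).comap comul := by
    refine sSup_le fun D hD c hc => ?_
    exact tensorSub_mono (le_sSup hD) (le_sSup hD) (hD.1 c hc)
  exact this

lemma coradFiltPrev_le (n : ℕ) : coradFiltPrev k C n ≤ coradFilt k C n := by
  cases n with
  | zero => exact bot_le
  | succ n =>
    induction n with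
    | zero =>
      intro c hc
      show comul c ∈ tensorSub ⊤ (coradical k C) ⊔ tensorSub (coradical k C) ⊤
      exact Submodule.mem_sup_right
        (tensorSub_mono le_rfl le_top (isSubcoalgebra_coradical k C c hc))
    | succ n ih => exact Submodule.comap_mono (sup_le_sup_right (tensorSub_mono le_rfl ih) _)

lemma coradFilt_mono : Monotone (coradFilt k C) :=
  monotone_nat_of_le_succ fun n => coradFiltPrev_le k C (n + 1)

lemma coradFilt_le_prev {i j : ℕ} (h : i < j) : coradFilt k C i ≤ coradFiltPrev k C j := by
  cases j with
  | zero => omega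
  | succ j => exact coradFilt_mono k C (by omega)

variable {k C} in
lemma map_comp_comul_left {M N P : Type*} [AddCommGroup M] [Module k M] [AddCommGroup N]
    [Module k N] [AddCommGroup P] [Module k P] (f : C →ₗ[k] M) (g : C →ₗ[k] N) (h : C →ₗ[k] P)
    (c : C) :
    TensorProduct.assoc k M N P (TensorProduct.map (TensorProduct.map f g ∘ₗ comul) h (comul c)) =
      TensorProduct.map f (TensorProduct.map g h ∘ₗ comul) (comul c) := by
  have e1 : TensorProduct.map (TensorProduct.map f g ∘ₗ comul) h =
      TensorProduct.map (TensorProduct.map f g) h ∘ₗ (comul (R := k) (A := C)).rTensor C := by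
    rw [LinearMap.rTensor, ← TensorProduct.map_comp]; simp
  have e2 : TensorProduct.map f (TensorProduct.map g h ∘ₗ comul) =
      TensorProduct.map f (TensorProduct.map g h) ∘ₗ (comul (R := k) (A := C)).lTensor C := by
    rw [LinearMap.lTensor, ← TensorProduct.map_comp]; simp
  rw [e1, e2, LinearMap.comp_apply, LinearMap.comp_apply, ← coassoc_apply]
  generalize (comul (R := k) (A := C)).rTensor C (comul c) = t
  have : (TensorProduct.assoc k M N P).toLinearMap ∘ₗ
      TensorProduct.map (TensorProduct.map f g) h =
      TensorProduct.map f (TensorProduct.map g h) ∘ₗ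
        (TensorProduct.assoc k C C C).toLinearMap := by
    ext; simp
  exact LinearMap.congr_fun this t

lemma coradFilt_succ_eq_ker (n : ℕ) : coradFiltPrev k C (n + 1 + 1) =
    LinearMap.ker (TensorProduct.map (coradFiltPrev k C 1).mkQ
      (coradFiltPrev k C (n + 1)).mkQ ∘ₗ comul) := by
  rw [LinearMap.ker_comp, ker_map_mkQ]; rfl

lemma comul_coideal (n : ℕ) :
    coradFilt k C n ≤ LinearMap.ker (TensorProduct.map (coradFiltPrev k C 0).mkQ
      (coradFiltPrev k C (n + 1)).mkQ ∘ₗ comul) := by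
  cases n with
  | zero =>
    intro c hc
    rw [LinearMap.ker_comp, ker_map_mkQ]
    exact Submodule.mem_sup_left
      (tensorSub_mono le_top le_rfl (isSubcoalgebra_coradical k C c hc))
  | succ n =>
    intro c hc
    obtain ⟨g, hg⟩ := exists_factor _ _ (coradFilt_succ_eq_ker k C n).symm
    have e : TensorProduct.map (coradFiltPrev k C 0).mkQ (coradFiltPrev k C (n + 1 + 1)).mkQ =
        TensorProduct.map LinearMap.id g ∘ₗ TensorProduct.map (coradFiltPrev k C 0).mkQ
          (TensorProduct.map (coradFiltPrev k C 1).mkQ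
            (coradFiltPrev k C (n + 1)).mkQ ∘ₗ comul) := by
      rw [← TensorProduct.map_comp, hg]; rfl
    rw [LinearMap.mem_ker, LinearMap.comp_apply, e, LinearMap.comp_apply]
    refine (congrArg _ ?_).trans (map_zero _)
    rw [← map_comp_comul_left]
    refine (congrArg _ ?_).trans (map_zero _)
    rw [← LinearMap.mem_ker]
    refine (?_ : tensorSub ⊤ (coradFilt k C n) ⊔ tensorSub (coradical k C) ⊤ ≤ _) hc
    refine sup_le (tensorSub_le fun a _ b hb => ?_) (tensorSub_le fun a ha b _ => ?_)
    · have : (coradFiltPrev k C (n + 1)).mkQ b = 0 := by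
        rw [← LinearMap.mem_ker, Submodule.ker_mkQ]; exact hb
      rw [LinearMap.mem_ker, TensorProduct.map_tmul, this, TensorProduct.tmul_zero]
    · have : (TensorProduct.map (coradFiltPrev k C 0).mkQ (coradFiltPrev k C 1).mkQ ∘ₗ comul) a
          = 0 := by
        rw [← LinearMap.mem_ker, LinearMap.ker_comp, ker_map_mkQ]
        exact Submodule.mem_sup_left
          (tensorSub_mono le_top le_rfl (isSubcoalgebra_coradical k C a ha))
      rw [LinearMap.mem_ker, TensorProduct.map_tmul, this, TensorProduct.zero_tmul]

lemma comul_wedge (n i j : ℕ) (h : i + j = n + 1) :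
    coradFilt k C n ≤ LinearMap.ker (TensorProduct.map (coradFiltPrev k C i).mkQ
      (coradFiltPrev k C j).mkQ ∘ₗ comul) := by
  induction n generalizing i j with
  | zero =>
    intro c hc
    obtain ⟨rfl, rfl⟩ | ⟨rfl, rfl⟩ : (i = 0 ∧ j = 1) ∨ (i = 1 ∧ j = 0) := by omega
    · exact comul_coideal k C 0 hc
    · rw [LinearMap.ker_comp, ker_map_mkQ]
      exact Submodule.mem_sup_right
        (tensorSub_mono le_rfl le_top (isSubcoalgebra_coradical k C c hc))
  | succ n ih =>
    obtain rfl | rfl | ⟨i, rfl⟩ : i = 0 ∨ i = 1 ∨ ∃ i', i = i' + 1 + 1 := by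
      rcases i with _ | _ | i
      · simp
      · simp
      · exact Or.inr (Or.inr ⟨i, rfl⟩)
    · obtain rfl : j = n + 1 + 1 := by omega
      exact comul_coideal k C (n + 1)
    · obtain rfl : j = n + 1 := by omega
      exact (coradFilt_succ_eq_ker k C n).le
    · intro c hc
      obtain ⟨g, hg⟩ := exists_factor _ _ (coradFilt_succ_eq_ker k C i).symm
      have e : TensorProduct.map (coradFiltPrev k C (i + 1 + 1)).mkQ (coradFiltPrev k C j).mkQ =
          TensorProduct.map g LinearMap.id ∘ₗ TensorProduct.map
            (TensorProduct.map (coradFiltPrev k C 1).mkQ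
              (coradFiltPrev k C (i + 1)).mkQ ∘ₗ comul) (coradFiltPrev k C j).mkQ := by
        rw [← TensorProduct.map_comp, hg]; rfl
      rw [LinearMap.mem_ker, LinearMap.comp_apply, e, LinearMap.comp_apply]
      refine (congrArg _ ?_).trans (map_zero _)
      apply (TensorProduct.assoc k _ _ _).injective
      rw [map_comp_comul_left, map_zero, ← LinearMap.mem_ker]
      refine (?_ : tensorSub ⊤ (coradFilt k C n) ⊔ tensorSub (coradical k C) ⊤ ≤ _) hc
      refine sup_le (tensorSub_le fun a _ b hb => ?_) (tensorSub_le fun a ha b _ => ?_)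
      · have := ih (i + 1) j (by omega) hb
        rw [LinearMap.mem_ker] at this
        rw [LinearMap.mem_ker, TensorProduct.map_tmul, this, TensorProduct.tmul_zero]
      · have : (coradFiltPrev k C 1).mkQ a = 0 := by
          rw [← LinearMap.mem_ker, Submodule.ker_mkQ]; exact ha
        rw [LinearMap.mem_ker, TensorProduct.map_tmul, this, TensorProduct.zero_tmul]

/-- The degree `n` term `∑_{i+j=n} C_i ⊗ C_j` of the tensor product filtration on `C ⊗ C`. -/
def tensorFilt (n : ℕ) : Submodule k (C ⊗[k] C) :=
  ⨆ ij ∈ Finset.HasAntidiagonal.antidiagonal n, tensorSub (coradFilt k C ij.1) (coradFilt k C ij.2)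

variable {k C}

lemma tmul_mem_tensorFilt {i j : ℕ} {a b : C} (ha : a ∈ coradFilt k C i)
    (hb : b ∈ coradFilt k C j) : a ⊗ₜ[k] b ∈ tensorFilt k C (i + j) :=
  Submodule.mem_iSup_of_mem (i, j) <| Submodule.mem_iSup_of_mem
    (Finset.HasAntidiagonal.mem_antidiagonal.2 rfl) (tmul_mem_tensorSub ha hb)

lemma tensorFilt_le {n : ℕ} {P : Submodule k (C ⊗[k] C)}
    (h : ∀ i j, i + j = n → ∀ a ∈ coradFilt k C i, ∀ b ∈ coradFilt k C j, a ⊗ₜ[k] b ∈ P) :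
    tensorFilt k C n ≤ P :=
  iSup₂_le fun ij hij => tensorSub_le (h ij.1 ij.2 (Finset.HasAntidiagonal.mem_antidiagonal.1 hij))

lemma tensorFilt_ext {M : Type*} [AddCommMonoid M] [Module k M] {f g : C ⊗[k] C →ₗ[k] M} {n : ℕ}
    (h : ∀ i j, i + j = n → ∀ a ∈ coradFilt k C i, ∀ b ∈ coradFilt k C j,
      f (a ⊗ₜ[k] b) = g (a ⊗ₜ[k] b)) {t : C ⊗[k] C} (ht : t ∈ tensorFilt k C n) : f t = g t :=
  (tensorFilt_le (P := LinearMap.eqLocus f g) h) ht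

/-- The coradical filtration is a coalgebra filtration: `Δ(C_n) ⊆ ∑_{i+j=n} C_i ⊗ C_j`. -/
lemma comul_mem_tensorFilt {n : ℕ} {c : C} (hc : c ∈ coradFilt k C n) :
    comul c ∈ tensorFilt k C n := by
  have key : ∀ m, m ≤ n + 1 → comul c ∈
      (tensorFilt k C n ⊓ tensorSub (coradFiltPrev k C m) ⊤) ⊔
        tensorSub ⊤ (coradFiltPrev k C (n + 1 - m)) := by
    intro m
    induction m with
    | zero =>
      intro _
      have := comul_wedge k C n 0 (n + 1) (by omega) hc
      rw [LinearMap.ker_comp, ker_map_mkQ] at this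
      refine Submodule.mem_sup_right ((sup_le le_rfl ?_ : _ ≤ tensorSub ⊤ _) this)
      exact tensorSub_le fun a ha b _ => by
        rw [(Submodule.mem_bot k).1 ha, TensorProduct.zero_tmul]; exact zero_mem _
    | succ m ih =>
      intro hm
      have h1 := ih (by omega)
      have h2 := comul_wedge k C n (m + 1) (n + 1 - (m + 1)) (by omega) hc
      rw [LinearMap.ker_comp, ker_map_mkQ] at h2
      obtain ⟨x, hx, y, hy, hxy⟩ := Submodule.mem_sup.1 h1
      obtain ⟨u, hu, v, hv, huv⟩ := Submodule.mem_sup.1 h2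
      have e1 : n + 1 - m = (n - m) + 1 := by omega
      have e2 : n + 1 - (m + 1) = n - m := by omega
      rw [e1] at hy
      rw [e2] at hu ⊢
      have hx2 : x ∈ tensorSub (coradFiltPrev k C (m + 1)) ⊤ :=
        tensorSub_mono (coradFiltPrev_le k C m) le_rfl hx.2
      have hw : y - u = v - x := by
        rw [sub_eq_sub_iff_add_eq_add, add_comm y x, hxy, ← huv, add_comm]
      have hw1 : y - u ∈ tensorSub ⊤ (coradFilt k C (n - m)) :=
        sub_mem hy (tensorSub_mono le_rfl (coradFiltPrev_le k C _) hu)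
      have hw2 : y - u ∈ tensorSub (coradFilt k C m) ⊤ := hw ▸ sub_mem hv hx2
      have hw3 := tensorSub_inf _ _ ⟨hw2, hw1⟩
      have hw4 : y - u ∈ tensorFilt k C n := by
        refine tensorSub_le (fun a ha b hb => ?_) hw3
        have := tmul_mem_tensorFilt ha hb
        rwa [show m + (n - m) = n by omega] at this
      refine Submodule.mem_sup.2 ⟨x + (y - u), ⟨add_mem hx.1 hw4, add_mem hx2 hw2⟩, u, hu, ?_⟩
      rw [← hxy]; abel
  have := key (n + 1) le_rfl
  rw [Nat.sub_self] at this
  refine (sup_le inf_le_left ?_ : _ ≤ tensorFilt k C n) this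
  exact tensorSub_le fun a _ b hb => by
    rw [(Submodule.mem_bot k).1 hb, TensorProduct.tmul_zero]; exact zero_mem _

variable (k C)

/-- The degree `n` piece `C_n / C_{n-1}` of the associated graded space. -/
def GrPiece (n : ℕ) : Type _ :=
  ↥(coradFilt k C n) ⧸ (coradFiltPrev k C n).submoduleOf (coradFilt k C n)

instance (n : ℕ) : AddCommGroup (GrPiece k C n) :=
  inferInstanceAs (AddCommGroup
    (↥(coradFilt k C n) ⧸ (coradFiltPrev k C n).submoduleOf (coradFilt k C n)))

instance (n : ℕ) : Module k (GrPiece k C n) :=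
  inferInstanceAs (Module k
    (↥(coradFilt k C n) ⧸ (coradFiltPrev k C n).submoduleOf (coradFilt k C n)))

/-- The quotient map `C_n → C_n / C_{n-1}`. -/
def grMk (n : ℕ) : coradFilt k C n →ₗ[k] GrPiece k C n :=
  ((coradFiltPrev k C n).submoduleOf (coradFilt k C n)).mkQ

variable {k C} in
lemma grMk_surjective (n : ℕ) : Function.Surjective (grMk k C n) :=
  Submodule.mkQ_surjective _

variable {k C} in
lemma grMk_eq_zero {n : ℕ} {c : coradFilt k C n} :
    grMk k C n c = 0 ↔ (c : C) ∈ coradFiltPrev k C n :=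
  Submodule.Quotient.mk_eq_zero _

variable {k C} in
/-- The linear map on `C_n / C_{n-1}` induced by a linear map on `C_n` vanishing on `C_{n-1}`. -/
def grLift {M : Type*} [AddCommMonoid M] [Module k M] (n : ℕ)
    (f : coradFilt k C n →ₗ[k] M) (h : ∀ c : coradFilt k C n, c.1 ∈ coradFiltPrev k C n → f c = 0) : GrPiece k C n →ₗ[k] M :=
  letI := Module.addCommMonoidToAddCommGroup k (M := M)
  Submodule.liftQ _ f fun c hc => h c hc

variable {k C} in
lemma grLift_grMk {M : Type*} [AddCommMonoid M] [Module k M] (n : ℕ)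
    (f : coradFilt k C n →ₗ[k] M) (h : ∀ c : coradFilt k C n, c.1 ∈ coradFiltPrev k C n → f c = 0) (c : coradFilt k C n) :
    grLift n f h (grMk k C n c) = f c := rfl

/-- The associated graded space `gr C = ⨁ C_n / C_{n-1}` of the coradical filtration. -/
abbrev Gr : Type _ := ⨁ n, GrPiece k C n

/-- A linear extension to `C` of the quotient map `C_n → C_n / C_{n-1}`. -/
def symbolPiece (n : ℕ) : C →ₗ[k] GrPiece k C n :=
  Classical.choose (LinearMap.exists_extend (grMk k C n))

lemma symbolPiece_apply (n : ℕ) (c : coradFilt k C n) :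
    symbolPiece k C n c = grMk k C n c :=
  LinearMap.congr_fun (Classical.choose_spec
    (LinearMap.exists_extend (grMk k C n))) c

/-- The map `symbolPiece k C n`, regarded as a map to `gr C`. On `C_n` it sends `c` to its class
in `C_n / C_{n-1}`; its values outside `C_n` are irrelevant. -/
def symbol (n : ℕ) : C →ₗ[k] Gr k C := DirectSum.lof k ℕ (GrPiece k C) n ∘ₗ symbolPiece k C n

variable {k C}

lemma lof_grMk (n : ℕ) (c : coradFilt k C n) :
    DirectSum.lof k ℕ (GrPiece k C) n (grMk k C n c) = symbol k C n c := by
  rw [symbol, LinearMap.comp_apply, symbolPiece_apply]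

lemma symbol_eq_zero {n : ℕ} {c : C} (hc : c ∈ coradFiltPrev k C n) : symbol k C n c = 0 := by
  have := lof_grMk n ⟨c, coradFiltPrev_le k C n hc⟩
  rw [← this, grMk_eq_zero.2 hc, map_zero]

lemma symbol_eq_zero_of_lt {i n : ℕ} {c : C} (hc : c ∈ coradFilt k C i) (h : i < n) :
    symbol k C n c = 0 :=
  symbol_eq_zero (coradFilt_le_prev k C h hc)

lemma gr_ext {M : Type*} [AddCommMonoid M] [Module k M] {f g : Gr k C →ₗ[k] M}
    (h : ∀ n, ∀ c ∈ coradFilt k C n, f (symbol k C n c) = g (symbol k C n c)) : f = g := by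
  refine DirectSum.linearMap_ext _ fun n => ?_
  refine LinearMap.ext fun x => ?_
  obtain ⟨c, rfl⟩ := grMk_surjective n x
  have := h n c c.2
  rw [← lof_grMk] at this
  exact this

variable (k C)

/-- The linear map `C ⊗ C → gr C ⊗ gr C` which, for `i + j = n`, `a ∈ C_i` and `b ∈ C_j`, sends
`a ⊗ b` to the tensor product of the class of `a` in `C_i / C_{i-1}` and the class of `b` in
`C_j / C_{j-1}`. -/
def symbolTensor (n : ℕ) : C ⊗[k] C →ₗ[k] Gr k C ⊗[k] Gr k C :=
  ∑ ij ∈ Finset.HasAntidiagonal.antidiagonal n,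
    TensorProduct.map (symbol k C ij.1) (symbol k C ij.2)

variable {k C}

lemma symbolTensor_tmul {i j : ℕ} {a b : C} (ha : a ∈ coradFilt k C i)
    (hb : b ∈ coradFilt k C j) :
    symbolTensor k C (i + j) (a ⊗ₜ[k] b) = symbol k C i a ⊗ₜ[k] symbol k C j b := by
  rw [symbolTensor, LinearMap.sum_apply]
  exact sum_antidiagonal_comp (symbol k C) (symbol k C) i j a b
    (fun _ => symbol_eq_zero_of_lt ha) (fun _ => symbol_eq_zero_of_lt hb)

lemma symbolTensor_eq_zero {m n : ℕ} (h : m < n) {t : C ⊗[k] C} (ht : t ∈ tensorFilt k C m) :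
    symbolTensor k C n t = 0 := by
  refine (tensorFilt_ext (f := symbolTensor k C n) (g := 0) (fun i j hij a ha b hb => ?_) ht)
  have h2 := symbolTensor_tmul (coradFilt_mono k C (show i ≤ n - j by omega) ha) hb
  rw [show n - j + j = n by omega] at h2
  rw [h2, symbol_eq_zero_of_lt ha (by omega)]
  simp

variable (k C)

/-- The comultiplication of `gr C`: it sends the class of `c ∈ C_n` to the class of `Δ(c)` in
`⨁_{i+j=n} C_i / C_{i-1} ⊗ C_j / C_{j-1}`. -/
def grComul : Gr k C →ₗ[k] Gr k C ⊗[k] Gr k C :=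
  DirectSum.toModule k ℕ _ fun n =>
      grLift n (symbolTensor k C n ∘ₗ comul ∘ₗ (coradFilt k C n).subtype) <| by
    rintro ⟨c, _⟩ hc
    change symbolTensor k C n (comul c) = 0
    cases n with
    | zero => rw [show c = 0 from (Submodule.mem_bot k).1 hc, map_zero, map_zero]
    | succ n => exact symbolTensor_eq_zero (Nat.lt_succ_self n) (comul_mem_tensorFilt hc)

/-- The counit of `gr C`: it is induced by the counit of `C` in degree `0`, and it vanishes in
positive degrees. -/
def grCounit : Gr k C →ₗ[k] k :=
  DirectSum.toModule k ℕ _ fun n => match n with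
    | 0 => grLift 0 (counit ∘ₗ (coradFilt k C 0).subtype) fun c hc => by
        rw [LinearMap.comp_apply, Submodule.subtype_apply, (Submodule.mem_bot k).1 hc, map_zero]
    | _ + 1 => 0

variable {k C}

lemma grComul_symbol {n : ℕ} {c : C} (hc : c ∈ coradFilt k C n) :
    grComul k C (symbol k C n c) = symbolTensor k C n (comul c) := by
  rw [← lof_grMk n ⟨c, hc⟩, grComul, DirectSum.toModule_lof]; rfl

lemma grCounit_symbol_zero {c : C} (hc : c ∈ coradFilt k C 0) :
    grCounit k C (symbol k C 0 c) = counit (R := k) c := by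
  rw [← lof_grMk 0 ⟨c, hc⟩, grCounit, DirectSum.toModule_lof]; rfl

lemma grCounit_symbol_pos {n : ℕ} (hn : n ≠ 0) (c : C) :
    grCounit k C (symbol k C n c) = 0 := by
  cases n with
  | zero => exact absurd rfl hn
  | succ n => rw [symbol, LinearMap.comp_apply, grCounit, DirectSum.toModule_lof]; rfl

variable (k C)

lemma gr_coassoc : (TensorProduct.assoc k (Gr k C) (Gr k C) (Gr k C)).toLinearMap ∘ₗ
    (grComul k C).rTensor (Gr k C) ∘ₗ grComul k C =
      (grComul k C).lTensor (Gr k C) ∘ₗ grComul k C := by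
  refine gr_ext fun n c hc => ?_
  simp only [LinearMap.comp_apply, LinearEquiv.coe_coe]
  rw [grComul_symbol hc]
  have hΔ := comul_mem_tensorFilt hc
  -- both sides are computed by the maps `symbol ⊗ (symbol ⊗ symbol)` on `C ⊗ (C ⊗ C)`
  have h1 : (grComul k C).rTensor (Gr k C) (symbolTensor k C n (comul c)) =
      (∑ ij ∈ Finset.HasAntidiagonal.antidiagonal n,
        TensorProduct.map (symbolTensor k C ij.1 ∘ₗ comul) (symbol k C ij.2)) (comul c) := by
    refine tensorFilt_ext (f := (grComul k C).rTensor (Gr k C) ∘ₗ symbolTensor k C n)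
      (fun i j hij a ha b hb => ?_) hΔ
    subst hij
    rw [LinearMap.comp_apply, symbolTensor_tmul ha hb, LinearMap.rTensor_tmul, grComul_symbol ha,
      LinearMap.sum_apply]
    exact (sum_antidiagonal_comp (fun m => symbolTensor k C m ∘ₗ comul) (symbol k C) i j a b
      (fun _ h => symbolTensor_eq_zero h (comul_mem_tensorFilt ha))
      (fun _ => symbol_eq_zero_of_lt hb)).symm
  have h2 : (grComul k C).lTensor (Gr k C) (symbolTensor k C n (comul c)) =
      (∑ ij ∈ Finset.HasAntidiagonal.antidiagonal n,
        TensorProduct.map (symbol k C ij.1) (symbolTensor k C ij.2 ∘ₗ comul)) (comul c) := by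
    refine tensorFilt_ext (f := (grComul k C).lTensor (Gr k C) ∘ₗ symbolTensor k C n)
      (fun i j hij a ha b hb => ?_) hΔ
    subst hij
    rw [LinearMap.comp_apply, symbolTensor_tmul ha hb, LinearMap.lTensor_tmul, grComul_symbol hb,
      LinearMap.sum_apply]
    exact (sum_antidiagonal_comp (symbol k C) (fun m => symbolTensor k C m ∘ₗ comul) i j a b
      (fun _ => symbol_eq_zero_of_lt ha)
      (fun _ h => symbolTensor_eq_zero h (comul_mem_tensorFilt hb))).symm
  rw [h1, h2, LinearMap.sum_apply, LinearMap.sum_apply, map_sum]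
  have e1 : ∀ i j : ℕ, (TensorProduct.assoc k (Gr k C) (Gr k C) (Gr k C))
      (TensorProduct.map (symbolTensor k C i ∘ₗ comul) (symbol k C j) (comul c)) =
      ∑ pq ∈ Finset.HasAntidiagonal.antidiagonal i, TensorProduct.map (symbol k C pq.1)
        (TensorProduct.map (symbol k C pq.2) (symbol k C j) ∘ₗ comul) (comul c) := by
    intro i j
    have : TensorProduct.map (symbolTensor k C i ∘ₗ comul) (symbol k C j) =
        ∑ pq ∈ Finset.HasAntidiagonal.antidiagonal i, TensorProduct.map
          (TensorProduct.map (symbol k C pq.1) (symbol k C pq.2) ∘ₗ comul) (symbol k C j) := by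
      refine TensorProduct.ext' fun a b => ?_
      simp [symbolTensor, LinearMap.sum_apply, TensorProduct.sum_tmul]
    rw [this, LinearMap.sum_apply, map_sum]
    exact Finset.sum_congr rfl fun pq _ => map_comp_comul_left _ _ _ _
  have e2 : ∀ i j : ℕ,
      TensorProduct.map (symbol k C i) (symbolTensor k C j ∘ₗ comul) (comul c) =
      ∑ pq ∈ Finset.HasAntidiagonal.antidiagonal j, TensorProduct.map (symbol k C i)
        (TensorProduct.map (symbol k C pq.1) (symbol k C pq.2) ∘ₗ comul) (comul c) := by
    intro i j
    have : TensorProduct.map (symbol k C i) (symbolTensor k C j ∘ₗ comul) =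
        ∑ pq ∈ Finset.HasAntidiagonal.antidiagonal j, TensorProduct.map (symbol k C i)
          (TensorProduct.map (symbol k C pq.1) (symbol k C pq.2) ∘ₗ comul) := by
      refine TensorProduct.ext' fun a b => ?_
      simp [symbolTensor, LinearMap.sum_apply, TensorProduct.tmul_sum]
    rw [this, LinearMap.sum_apply]
  simp only [e1, e2]
  generalize hF : (fun p q r => TensorProduct.map (symbol k C p)
    (TensorProduct.map (symbol k C q) (symbol k C r) ∘ₗ comul) (comul c)) = F
  have hF' : ∀ p q r, TensorProduct.map (symbol k C p)
    (TensorProduct.map (symbol k C q) (symbol k C r) ∘ₗ comul) (comul c) = F p q r := by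
    intro p q r; rw [← hF]
  simp only [hF']
  rw [Finset.sum_sigma', Finset.sum_sigma']
  refine Finset.sum_nbij' (fun x => ⟨(x.2.1, x.2.2 + x.1.2), (x.2.2, x.1.2)⟩)
    (fun x => ⟨(x.1.1 + x.2.1, x.2.2), (x.1.1, x.2.1)⟩) ?_ ?_ ?_ ?_ ?_
  · rintro ⟨⟨a, b⟩, ⟨p, q⟩⟩ h
    simp only [Finset.mem_sigma, Finset.HasAntidiagonal.mem_antidiagonal] at h ⊢
    obtain ⟨h1, h2⟩ := h
    exact ⟨by omega, trivial⟩
  · rintro ⟨⟨a, b⟩, ⟨p, q⟩⟩ h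
    simp only [Finset.mem_sigma, Finset.HasAntidiagonal.mem_antidiagonal] at h ⊢
    obtain ⟨h1, h2⟩ := h
    exact ⟨by omega, trivial⟩
  · rintro ⟨⟨a, b⟩, ⟨p, q⟩⟩ h
    simp only [Finset.mem_sigma, Finset.HasAntidiagonal.mem_antidiagonal] at h
    obtain ⟨_, rfl⟩ := h
    rfl
  · rintro ⟨⟨a, b⟩, ⟨p, q⟩⟩ h
    simp only [Finset.mem_sigma, Finset.HasAntidiagonal.mem_antidiagonal] at h
    obtain ⟨_, rfl⟩ := h
    rfl
  · rintro ⟨⟨a, b⟩, ⟨p, q⟩⟩ h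
    rfl

lemma gr_rTensor : (grCounit k C).rTensor (Gr k C) ∘ₗ grComul k C =
    TensorProduct.mk k k (Gr k C) 1 := by
  refine gr_ext fun n c hc => ?_
  rw [LinearMap.comp_apply, grComul_symbol hc]
  have h1 : (grCounit k C).rTensor (Gr k C) (symbolTensor k C n (comul c)) =
      TensorProduct.map counit (symbol k C n) (comul c) := by
    refine tensorFilt_ext (f := (grCounit k C).rTensor (Gr k C) ∘ₗ symbolTensor k C n)
      (fun i j hij a ha b hb => ?_) (comul_mem_tensorFilt hc)
    subst hij
    rw [LinearMap.comp_apply, symbolTensor_tmul ha hb, LinearMap.rTensor_tmul,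
      TensorProduct.map_tmul]
    rcases Nat.eq_zero_or_pos i with rfl | hi
    · rw [grCounit_symbol_zero ha, Nat.zero_add]
    · rw [grCounit_symbol_pos hi.ne', symbol_eq_zero_of_lt (n := i + j) hb (by omega)]; simp
  have h2 : TensorProduct.map counit (symbol k C n) =
      (symbol k C n).lTensor k ∘ₗ (counit (R := k) (A := C)).rTensor C := by
    ext; simp
  rw [h1, h2, LinearMap.comp_apply, rTensor_counit_comul]; simp

lemma gr_lTensor : (grCounit k C).lTensor (Gr k C) ∘ₗ grComul k C =
    (TensorProduct.mk k (Gr k C) k).flip 1 := by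
  refine gr_ext fun n c hc => ?_
  rw [LinearMap.comp_apply, grComul_symbol hc]
  have h1 : (grCounit k C).lTensor (Gr k C) (symbolTensor k C n (comul c)) =
      TensorProduct.map (symbol k C n) counit (comul c) := by
    refine tensorFilt_ext (f := (grCounit k C).lTensor (Gr k C) ∘ₗ symbolTensor k C n)
      (fun i j hij a ha b hb => ?_) (comul_mem_tensorFilt hc)
    subst hij
    rw [LinearMap.comp_apply, symbolTensor_tmul ha hb, LinearMap.lTensor_tmul,
      TensorProduct.map_tmul]
    rcases Nat.eq_zero_or_pos j with rfl | hj
    · rw [grCounit_symbol_zero hb, Nat.add_zero]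
    · rw [grCounit_symbol_pos hj.ne', symbol_eq_zero_of_lt (n := i + j) ha (by omega)]; simp
  have h2 : TensorProduct.map (symbol k C n) counit =
      (symbol k C n).rTensor k ∘ₗ (counit (R := k) (A := C)).lTensor C := by
    ext; simp
  rw [h1, h2, LinearMap.comp_apply, lTensor_counit_comul]; simp

/-- The associated graded coalgebra. -/
instance grCoalgebra : Coalgebra k (Gr k C) where
  comul := grComul k C
  counit := grCounit k C
  coassoc := gr_coassoc k C
  rTensor_counit_comp_comul := gr_rTensor k C
  lTensor_counit_comp_comul := gr_lTensor k C

end Coalg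

section Hopf

open HopfAlgebra

variable {k : Type*} {H : Type*} [Field k] [Ring H] [HopfAlgebra k H]

lemma mul_antipode_comul (h : H) : LinearMap.mul' k (H ⊗[k] H) (TensorProduct.map
    ((TensorProduct.mk k H H).flip 1 ∘ₗ antipode k) comul (comul h)) = 1 ⊗ₜ[k] h := by
  have e : ∀ (a : H) (t : H ⊗[k] H), (antipode k a ⊗ₜ[k] (1 : H)) * t =
      TensorProduct.map (LinearMap.mul' k H ∘ₗ (antipode k).rTensor H) LinearMap.id
        ((TensorProduct.assoc k H H H).symm (a ⊗ₜ[k] t)) := by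
    intro a t
    induction t with
    | zero => simp
    | tmul x y => simp
    | add x y hx hy => rw [mul_add, TensorProduct.tmul_add, map_add, map_add, hx, hy]
  have e2 : LinearMap.mul' k (H ⊗[k] H) ∘ₗ TensorProduct.map
      ((TensorProduct.mk k H H).flip 1 ∘ₗ antipode k) comul =
      TensorProduct.map (LinearMap.mul' k H ∘ₗ (antipode k).rTensor H) LinearMap.id ∘ₗ
        (TensorProduct.assoc k H H H).symm.toLinearMap ∘ₗ
          (comul (R := k) (A := H)).lTensor H := by
    refine TensorProduct.ext' fun a b => ?_
    simpa using e a (comul b)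
  have e3 := LinearMap.congr_fun e2 (comul h)
  simp only [LinearMap.comp_apply, LinearEquiv.coe_coe] at e3
  rw [e3, ← coassoc_apply, LinearEquiv.symm_apply_apply]
  have e4 : TensorProduct.map (LinearMap.mul' k H ∘ₗ (antipode k).rTensor H) LinearMap.id ∘ₗ
      (comul (R := k) (A := H)).rTensor H =
      (Algebra.linearMap k H).rTensor H ∘ₗ (counit (R := k) (A := H)).rTensor H := by
    refine TensorProduct.ext' fun a b => ?_
    simp
  have e5 := LinearMap.congr_fun e4 (comul h)
  rw [LinearMap.comp_apply, LinearMap.comp_apply, rTensor_counit_comul] at e5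
  rw [e5]; simp

/-- `Δ(S(h)) = ∑ S(h₂) ⊗ S(h₁)`. -/
lemma comul_antipode (h : H) : comul (antipode k h) =
    TensorProduct.map (antipode k) (antipode k) (TensorProduct.comm k H H (comul h)) := by
  have key : WithConv.toConv (TensorProduct.map (antipode k) (antipode k) ∘ₗ
      (TensorProduct.comm k H H).toLinearMap ∘ₗ comul) *
      WithConv.toConv (comul (R := k) (A := H)) = 1 := by
    apply WithConv.ofConv_injective
    refine LinearMap.ext fun x => ?_
    change LinearMap.mul' k (H ⊗[k] H) (TensorProduct.map (TensorProduct.map (antipode k)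
      (antipode k) ∘ₗ (TensorProduct.comm k H H).toLinearMap ∘ₗ comul) comul (comul x)) =
      algebraMap k (H ⊗[k] H) (counit x)
    let Φ : H ⊗[k] (H ⊗[k] H) →ₗ[k] H ⊗[k] H := LinearMap.mul' k (H ⊗[k] H) ∘ₗ
      TensorProduct.map (TensorProduct.mk k H H 1 ∘ₗ antipode k)
        (LinearMap.mul' k (H ⊗[k] H) ∘ₗ TensorProduct.map
          ((TensorProduct.mk k H H).flip 1 ∘ₗ antipode k) comul)
    have e1 : LinearMap.mul' k (H ⊗[k] H) ∘ₗ TensorProduct.map (TensorProduct.map (antipode k)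
        (antipode k) ∘ₗ (TensorProduct.comm k H H).toLinearMap ∘ₗ comul) comul =
        Φ ∘ₗ (TensorProduct.assoc k H H H).toLinearMap ∘ₗ
          (comul (R := k) (A := H)).rTensor H := by
      refine TensorProduct.ext' fun a b => ?_
      simp only [LinearMap.comp_apply, TensorProduct.map_tmul, LinearMap.rTensor_tmul,
        LinearEquiv.coe_coe, LinearMap.mul'_apply]
      generalize comul (R := k) a = t
      induction t with
      | zero => simp
      | tmul x y =>
        simp only [Φ, TensorProduct.comm_tmul, TensorProduct.map_tmul, TensorProduct.assoc_tmul,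
          LinearMap.comp_apply, LinearMap.mul'_apply, TensorProduct.mk_apply,
          LinearMap.flip_apply]
        rw [← mul_assoc, Algebra.TensorProduct.tmul_mul_tmul, one_mul, mul_one]
      | add x y hx hy =>
        rw [map_add, map_add, add_mul, hx, hy, TensorProduct.add_tmul, map_add, map_add]
    have e2 := LinearMap.congr_fun e1 (comul x)
    simp only [LinearMap.comp_apply, LinearEquiv.coe_coe] at e2
    rw [e2, coassoc_apply]
    have e3 : Φ ∘ₗ (comul (R := k) (A := H)).lTensor H =
        TensorProduct.mk k H H 1 ∘ₗ LinearMap.mul' k H ∘ₗ (antipode k).rTensor H := by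
      refine TensorProduct.ext' fun a b => ?_
      have := mul_antipode_comul (k := k) b
      simp only [Φ, LinearMap.comp_apply, TensorProduct.map_tmul, LinearMap.lTensor_tmul,
        LinearMap.mul'_apply, this, TensorProduct.mk_apply, LinearMap.rTensor_tmul,
        Algebra.TensorProduct.tmul_mul_tmul, one_mul]
    have e4 := LinearMap.congr_fun e3 (comul x)
    simp only [LinearMap.comp_apply] at e4
    rw [e4, mul_antipode_rTensor_comul_apply, Algebra.TensorProduct.algebraMap_apply,
      TensorProduct.mk_apply, Algebra.algebraMap_eq_smul_one, TensorProduct.tmul_smul,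
      TensorProduct.smul_tmul']
  have := left_inv_eq_right_inv key LinearMap.comul_right_inv
  exact (LinearMap.congr_fun (WithConv.toConv_injective this) h).symm

lemma mem_coradFilt_succ {n : ℕ} {c : H} : c ∈ coradFilt k H (n + 1) ↔
    comul c ∈ tensorSub ⊤ (coradFilt k H n) ⊔ tensorSub (coradFilt k H 0) ⊤ := Iff.rfl

lemma grMk_sigma_ext {i j : ℕ} (h : i = j) (a : coradFilt k H i) (b : coradFilt k H j)
    (hab : (a : H) = b) :
    GradedMonoid.mk (A := GrPiece k H) i (grMk k H i a) = GradedMonoid.mk j (grMk k H j b) := by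
  subst h
  rw [Subtype.ext hab]

section Pointed

variable [IsPointed k H]

lemma coradFilt_zero_eq : coradFilt k H 0 = Submodule.span k {g : H | IsGroupLikeElem k g} :=
  IsPointed.coradical_eq

lemma one_mem_coradFilt : (1 : H) ∈ coradFilt k H 0 := by
  rw [coradFilt_zero_eq]; exact Submodule.subset_span IsGroupLikeElem.one

lemma mul_mem_coradFilt_zero {a b : H} (ha : a ∈ coradFilt k H 0) (hb : b ∈ coradFilt k H 0) :
    a * b ∈ coradFilt k H 0 := by
  rw [coradFilt_zero_eq] at *
  have := Submodule.mul_mem_mul ha hb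
  rw [Submodule.span_mul_span] at this
  refine Submodule.span_mono ?_ this
  rintro _ ⟨g, hg, g', hg', rfl⟩
  exact IsGroupLikeElem.mul hg hg'

/-- The coradical filtration of a pointed Hopf algebra is an algebra filtration. -/
lemma mul_mem_coradFilt {i j : ℕ} {a b : H} (ha : a ∈ coradFilt k H i)
    (hb : b ∈ coradFilt k H j) : a * b ∈ coradFilt k H (i + j) := by
  obtain ⟨n, hn⟩ : ∃ n, i + j = n := ⟨_, rfl⟩
  induction n using Nat.strong_induction_on generalizing i j a b with
  | _ n ih =>
    cases n with
    | zero =>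
      obtain ⟨rfl, rfl⟩ : i = 0 ∧ j = 0 := by omega
      exact mul_mem_coradFilt_zero ha hb
    | succ n =>
      rw [hn, mem_coradFilt_succ, Bialgebra.comul_mul]
      have hb' := comul_mem_tensorFilt hb
      generalize comul (R := k) b = s at hb'
      have ha' := comul_mem_tensorFilt ha
      generalize comul (R := k) a = t at ha'
      revert t
      suffices tensorFilt k H i ≤ (tensorSub ⊤ (coradFilt k H n) ⊔
          tensorSub (coradFilt k H 0) ⊤).comap (LinearMap.mulRight k s) from
        fun t ht => this ht
      refine tensorFilt_le fun p q hpq x hx y hy => ?_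
      rw [Submodule.mem_comap, LinearMap.mulRight_apply]
      suffices tensorFilt k H j ≤ (tensorSub ⊤ (coradFilt k H n) ⊔
          tensorSub (coradFilt k H 0) ⊤).comap (LinearMap.mulLeft k (x ⊗ₜ[k] y)) from this hb'
      refine tensorFilt_le fun p' q' hpq' x' hx' y' hy' => ?_
      rw [Submodule.mem_comap, LinearMap.mulLeft_apply, Algebra.TensorProduct.tmul_mul_tmul]
      by_cases h0 : q + q' = n + 1
      · obtain ⟨rfl, rfl⟩ : p = 0 ∧ p' = 0 := by omega
        exact Submodule.mem_sup_right
          (tmul_mem_tensorSub (mul_mem_coradFilt_zero hx hx') Submodule.mem_top)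
      · refine Submodule.mem_sup_left (tmul_mem_tensorSub Submodule.mem_top ?_)
        exact coradFilt_mono k H (show q + q' ≤ n by omega)
          (ih (q + q') (by omega) hy hy' rfl)

lemma mul_mem_prev_left {i j : ℕ} {a b : H} (ha : a ∈ coradFiltPrev k H i)
    (hb : b ∈ coradFilt k H j) : a * b ∈ coradFiltPrev k H (i + j) := by
  cases i with
  | zero => rw [(Submodule.mem_bot k).1 ha, zero_mul]; exact zero_mem _
  | succ i =>
    exact coradFilt_le_prev k H (show i + j < i + 1 + j by omega)
      (mul_mem_coradFilt (show a ∈ coradFilt k H i from ha) hb)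

lemma mul_mem_prev_right {i j : ℕ} {a b : H} (ha : a ∈ coradFilt k H i)
    (hb : b ∈ coradFiltPrev k H j) : a * b ∈ coradFiltPrev k H (i + j) := by
  cases j with
  | zero => rw [(Submodule.mem_bot k).1 hb, mul_zero]; exact zero_mem _
  | succ j => exact mul_mem_coradFilt ha hb

/-- The coradical filtration of a pointed Hopf algebra is stable under the antipode. -/
lemma antipode_mem_coradFilt {n : ℕ} {c : H} (hc : c ∈ coradFilt k H n) :
    antipode k c ∈ coradFilt k H n := by
  have h0 : coradFilt k H 0 ≤ (coradFilt k H 0).comap (antipode k) := by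
    rw [coradFilt_zero_eq, Submodule.span_le]
    exact fun g hg => Submodule.subset_span (IsGroupLikeElem.antipode hg)
  induction n using Nat.strong_induction_on generalizing c with
  | _ n ih =>
    cases n with
    | zero => exact h0 hc
    | succ n =>
      rw [mem_coradFilt_succ, comul_antipode]
      refine (tensorFilt_le (P := (tensorSub ⊤ (coradFilt k H n) ⊔
        tensorSub (coradFilt k H 0) ⊤).comap (TensorProduct.map (antipode k) (antipode k) ∘ₗ
          (TensorProduct.comm k H H).toLinearMap)) fun i j hij a ha b hb => ?_)
          (comul_mem_tensorFilt hc)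
      change antipode k b ⊗ₜ[k] antipode k a ∈
        tensorSub ⊤ (coradFilt k H n) ⊔ tensorSub (coradFilt k H 0) ⊤
      rcases Nat.eq_zero_or_pos j with rfl | hj
      · exact Submodule.mem_sup_right (tmul_mem_tensorSub (h0 hb) Submodule.mem_top)
      · exact Submodule.mem_sup_left (tmul_mem_tensorSub Submodule.mem_top
          (coradFilt_mono k H (show i ≤ n by omega) (ih i (by omega) ha)))

variable (k H)

/-- The product `H_i / H_{i-1} × H_j / H_{j-1} → H_{i+j} / H_{i+j-1}` induced by the product of
`H`. -/
def grMul (i j : ℕ) : GrPiece k H i →ₗ[k] GrPiece k H j →ₗ[k] GrPiece k H (i + j) :=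
  LinearMap.flip <| grLift j
    (LinearMap.flip <| grLift i
      (LinearMap.mk₂ k
        (fun (a : coradFilt k H i) (b : coradFilt k H j) =>
          grMk k H (i + j) ⟨(a : H) * (b : H), mul_mem_coradFilt a.2 b.2⟩)
        (fun a a' b => by
          rw [← map_add]; exact congrArg _ (Subtype.ext (add_mul _ _ _)))
        (fun r a b => by
          rw [← map_smul]; exact congrArg _ (Subtype.ext (smul_mul_assoc _ _ _)))
        (fun a b b' => by
          rw [← map_add]; exact congrArg _ (Subtype.ext (mul_add _ _ _)))
        (fun r a b => by
          rw [← map_smul]; exact congrArg _ (Subtype.ext (mul_smul_comm _ _ _))))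
      (fun a ha => LinearMap.ext fun b => grMk_eq_zero.2 (mul_mem_prev_left ha b.2)))
    (fun b hb => LinearMap.ext fun x => by
      obtain ⟨a, rfl⟩ := grMk_surjective i x
      exact grMk_eq_zero.2 (mul_mem_prev_right a.2 hb))

variable {k H}

lemma grMul_grMk {i j : ℕ} (a : coradFilt k H i) (b : coradFilt k H j) :
    grMul k H i j (grMk k H i a) (grMk k H j b) =
      grMk k H (i + j) ⟨(a : H) * (b : H), mul_mem_coradFilt a.2 b.2⟩ := rfl

instance : GradedMonoid.GMul (GrPiece k H) where
  mul {i j} x y := grMul k H i j x y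

instance : GradedMonoid.GOne (GrPiece k H) where
  one := grMk k H 0 ⟨1, one_mem_coradFilt⟩

instance : DirectSum.GRing (GrPiece k H) where
  mul {i j} x y := grMul k H i j x y
  mul_zero x := map_zero _
  zero_mul y := by rw [map_zero]; rfl
  mul_add x y y' := map_add _ _ _
  add_mul x x' y := by rw [map_add]; rfl
  one := grMk k H 0 ⟨1, one_mem_coradFilt⟩
  one_mul := by
    rintro ⟨i, x⟩
    obtain ⟨a, rfl⟩ := grMk_surjective i x
    exact grMk_sigma_ext (zero_add i) _ _ (one_mul _)
  mul_one := by
    rintro ⟨i, x⟩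
    obtain ⟨a, rfl⟩ := grMk_surjective i x
    exact grMk_sigma_ext (add_zero i) _ _ (mul_one _)
  mul_assoc := by
    rintro ⟨i, x⟩ ⟨j, y⟩ ⟨l, z⟩
    obtain ⟨a, rfl⟩ := grMk_surjective i x
    obtain ⟨b, rfl⟩ := grMk_surjective j y
    obtain ⟨c, rfl⟩ := grMk_surjective l z
    exact grMk_sigma_ext (add_assoc i j l) _ _ (mul_assoc _ _ _)
  natCast n := n • grMk k H 0 ⟨1, one_mem_coradFilt⟩
  natCast_zero := zero_nsmul _
  natCast_succ n := succ_nsmul _ n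
  intCast z := z • grMk k H 0 ⟨1, one_mem_coradFilt⟩
  intCast_ofNat n := natCast_zsmul _ n
  intCast_negSucc_ofNat n := negSucc_zsmul _ n

instance : DirectSum.GAlgebra k (GrPiece k H) where
  toFun := (LinearMap.toSpanSingleton k (GrPiece k H 0)
    (grMk k H 0 ⟨1, one_mem_coradFilt⟩)).toAddMonoidHom
  map_one := one_smul k (grMk k H 0 ⟨1, one_mem_coradFilt⟩)
  map_mul r s := grMk_sigma_ext rfl ((r * s) • ⟨1, one_mem_coradFilt⟩)
    ⟨(r • (1 : H)) * (s • (1 : H)), mul_mem_coradFilt (Submodule.smul_mem _ _ one_mem_coradFilt)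
      (Submodule.smul_mem _ _ one_mem_coradFilt)⟩
    (show (r * s) • (1 : H) = (r • 1) * (s • 1) by rw [smul_mul_smul_comm, one_mul])
  commutes r := by
    rintro ⟨i, x⟩
    obtain ⟨a, rfl⟩ := grMk_surjective i x
    exact grMk_sigma_ext ((zero_add i).trans (add_zero i).symm)
      ⟨(r • (1 : H)) * (a : H), mul_mem_coradFilt
        (Submodule.smul_mem _ _ one_mem_coradFilt) a.2⟩
      ⟨(a : H) * (r • (1 : H)), mul_mem_coradFilt a.2
        (Submodule.smul_mem _ _ one_mem_coradFilt)⟩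
      (show (r • (1 : H)) * (a : H) = (a : H) * (r • (1 : H)) by simp)
  smul_def r := by
    rintro ⟨i, x⟩
    obtain ⟨a, rfl⟩ := grMk_surjective i x
    exact grMk_sigma_ext (zero_add i).symm (r • a)
      ⟨(r • (1 : H)) * (a : H), mul_mem_coradFilt
        (Submodule.smul_mem _ _ one_mem_coradFilt) a.2⟩
      (show r • (a : H) = (r • (1 : H)) * (a : H) by simp)

lemma one_eq_symbol : (1 : Gr k H) = symbol k H 0 1 :=
  lof_grMk 0 ⟨1, one_mem_coradFilt⟩

lemma symbol_mul_symbol {i j : ℕ} {a b : H} (ha : a ∈ coradFilt k H i)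
    (hb : b ∈ coradFilt k H j) :
    symbol k H i a * symbol k H j b = symbol k H (i + j) (a * b) := by
  rw [← lof_grMk i ⟨a, ha⟩, ← lof_grMk j ⟨b, hb⟩,
    ← lof_grMk (i + j) ⟨a * b, mul_mem_coradFilt ha hb⟩]
  exact DirectSum.of_mul_of _ _

lemma symbolTensor_mul {m n : ℕ} {t s : H ⊗[k] H} (ht : t ∈ tensorFilt k H m)
    (hs : s ∈ tensorFilt k H n) :
    symbolTensor k H (m + n) (t * s) = symbolTensor k H m t * symbolTensor k H n s := by
  refine tensorFilt_ext (f := symbolTensor k H (m + n) ∘ₗ LinearMap.mulRight k s)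
    (g := LinearMap.mulRight k (symbolTensor k H n s) ∘ₗ symbolTensor k H m)
    (fun i j hij a ha b hb => ?_) ht
  refine tensorFilt_ext (f := symbolTensor k H (m + n) ∘ₗ LinearMap.mulLeft k (a ⊗ₜ[k] b))
    (g := LinearMap.mulLeft k (symbolTensor k H m (a ⊗ₜ[k] b)) ∘ₗ symbolTensor k H n)
    (fun i' j' hij' a' ha' b' hb' => ?_) hs
  subst hij hij'
  simp only [LinearMap.comp_apply, LinearMap.mulLeft_apply, Algebra.TensorProduct.tmul_mul_tmul,
    symbolTensor_tmul ha hb, symbolTensor_tmul ha' hb', symbol_mul_symbol ha ha',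
    symbol_mul_symbol hb hb']
  rw [show i + j + (i' + j') = (i + i') + (j + j') by omega,
    symbolTensor_tmul (mul_mem_coradFilt ha ha') (mul_mem_coradFilt hb hb')]

/-- The associated graded bialgebra of a pointed Hopf algebra. -/
instance grBialgebra : Bialgebra k (Gr k H) where
  counit_one := by
    change grCounit k H 1 = 1
    rw [one_eq_symbol, grCounit_symbol_zero one_mem_coradFilt, Bialgebra.counit_one]
  mul_compr₂_counit := by
    refine gr_ext fun m a ha => gr_ext fun n b hb => ?_
    change grCounit k H (symbol k H m a * symbol k H n b) =
      grCounit k H (symbol k H m a) * grCounit k H (symbol k H n b)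
    rw [symbol_mul_symbol ha hb]
    rcases Nat.eq_zero_or_pos m with rfl | hm
    · rcases Nat.eq_zero_or_pos n with rfl | hn
      · rw [grCounit_symbol_zero ha, grCounit_symbol_zero hb,
          grCounit_symbol_zero (mul_mem_coradFilt ha hb), Bialgebra.counit_mul]
      · rw [grCounit_symbol_pos (by omega), grCounit_symbol_pos hn.ne', mul_zero]
    · rw [grCounit_symbol_pos (by omega), grCounit_symbol_pos hm.ne', zero_mul]
  comul_one := by
    change grComul k H 1 = 1
    rw [one_eq_symbol, grComul_symbol one_mem_coradFilt, Bialgebra.comul_one,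
      Algebra.TensorProduct.one_def, Algebra.TensorProduct.one_def, one_eq_symbol]
    exact symbolTensor_tmul one_mem_coradFilt one_mem_coradFilt
  mul_compr₂_comul := by
    refine gr_ext fun m a ha => gr_ext fun n b hb => ?_
    change grComul k H (symbol k H m a * symbol k H n b) =
      grComul k H (symbol k H m a) * grComul k H (symbol k H n b)
    rw [symbol_mul_symbol ha hb, grComul_symbol ha, grComul_symbol hb,
      grComul_symbol (mul_mem_coradFilt ha hb), Bialgebra.comul_mul,
      symbolTensor_mul (comul_mem_tensorFilt ha) (comul_mem_tensorFilt hb)]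

variable (k H)

/-- The antipode of `gr H`: it sends the class of `h ∈ H_n` to the class of `S(h) ∈ H_n`. -/
def grAntipode : Gr k H →ₗ[k] Gr k H :=
  DirectSum.toModule k ℕ _ fun n =>
    grLift n (symbol k H n ∘ₗ antipode k ∘ₗ (coradFilt k H n).subtype) <| by
      rintro ⟨c, _⟩ hc
      change symbol k H n (antipode k c) = 0
      cases n with
      | zero => rw [show c = 0 from (Submodule.mem_bot k).1 hc, map_zero, map_zero]
      | succ n => exact symbol_eq_zero (antipode_mem_coradFilt (n := n) hc)

variable {k H}

lemma grAntipode_symbol {n : ℕ} {c : H} (hc : c ∈ coradFilt k H n) :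
    grAntipode k H (symbol k H n c) = symbol k H n (antipode k c) := by
  rw [← lof_grMk n ⟨c, hc⟩, grAntipode, DirectSum.toModule_lof]; rfl

lemma algebraMap_grCounit {n : ℕ} {c : H} (hc : c ∈ coradFilt k H n) :
    algebraMap k (Gr k H) (grCounit k H (symbol k H n c)) =
      symbol k H n (algebraMap k H (counit c)) := by
  rcases Nat.eq_zero_or_pos n with rfl | hn
  · rw [grCounit_symbol_zero hc, Algebra.algebraMap_eq_smul_one, Algebra.algebraMap_eq_smul_one,
      map_smul, one_eq_symbol]
  · rw [grCounit_symbol_pos hn.ne', map_zero, Algebra.algebraMap_eq_smul_one, map_smul,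
      symbol_eq_zero_of_lt one_mem_coradFilt hn, smul_zero]

/-- The associated graded Hopf algebra `gr H` of a pointed Hopf algebra `H` with respect to the
coradical filtration. -/
instance grHopfAlgebra : HopfAlgebra k (Gr k H) where
  antipode := grAntipode k H
  mul_antipode_rTensor_comul := by
    refine gr_ext fun n c hc => ?_
    change LinearMap.mul' k (Gr k H) ((grAntipode k H).rTensor (Gr k H)
      (grComul k H (symbol k H n c))) = algebraMap k (Gr k H) (grCounit k H (symbol k H n c))
    rw [grComul_symbol hc, algebraMap_grCounit hc, ← mul_antipode_rTensor_comul_apply]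
    refine tensorFilt_ext (f := LinearMap.mul' k (Gr k H) ∘ₗ (grAntipode k H).rTensor (Gr k H) ∘ₗ
      symbolTensor k H n) (g := symbol k H n ∘ₗ LinearMap.mul' k H ∘ₗ (antipode k).rTensor H)
      (fun i j hij a ha b hb => ?_) (comul_mem_tensorFilt hc)
    subst hij
    simp only [LinearMap.comp_apply, symbolTensor_tmul ha hb, LinearMap.rTensor_tmul,
      LinearMap.mul'_apply, grAntipode_symbol ha, symbol_mul_symbol (antipode_mem_coradFilt ha) hb]
  mul_antipode_lTensor_comul := by
    refine gr_ext fun n c hc => ?_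
    change LinearMap.mul' k (Gr k H) ((grAntipode k H).lTensor (Gr k H)
      (grComul k H (symbol k H n c))) = algebraMap k (Gr k H) (grCounit k H (symbol k H n c))
    rw [grComul_symbol hc, algebraMap_grCounit hc, ← mul_antipode_lTensor_comul_apply]
    refine tensorFilt_ext (f := LinearMap.mul' k (Gr k H) ∘ₗ (grAntipode k H).lTensor (Gr k H) ∘ₗ
      symbolTensor k H n) (g := symbol k H n ∘ₗ LinearMap.mul' k H ∘ₗ (antipode k).lTensor H)
      (fun i j hij a ha b hb => ?_) (comul_mem_tensorFilt hc)
    subst hij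
    simp only [LinearMap.comp_apply, symbolTensor_tmul ha hb, LinearMap.lTensor_tmul,
      LinearMap.mul'_apply, grAntipode_symbol hb, symbol_mul_symbol ha (antipode_mem_coradFilt hb)]

end Pointed

section Invariants

variable (k : Type*) (H : Type*) [Field k] [Ring H] [HopfAlgebra k H]

variable {k H} in
/-- The space `P_{x,y}(H) = {h | Δ(h) = h ⊗ x + y ⊗ h}` of `(x, y)`-skew-primitive elements. -/
def skewPrimitive (x y : GroupLike k H) : Submodule k H where
  carrier := {h | comul (R := k) h = h ⊗ₜ[k] (x : H) + (y : H) ⊗ₜ[k] h}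
  zero_mem' := by simp
  add_mem' {a b} ha hb := by
    simp only [Set.mem_ofPred_eq] at ha hb ⊢
    rw [map_add, ha, hb, TensorProduct.add_tmul, TensorProduct.tmul_add]; abel
  smul_mem' r a ha := by
    simp only [Set.mem_ofPred_eq] at ha ⊢
    rw [map_smul, ha, smul_add, TensorProduct.smul_tmul', TensorProduct.tmul_smul]

variable {k H} in
/-- The group-like elements `g` acting trivially by conjugation on the subspace `P`. -/
def conjCentralizer (P : Submodule k H) : Subgroup (GroupLike k H) where
  carrier := {g | ∀ h ∈ P, (g : H) * h * ((g⁻¹ : GroupLike k H) : H) = h}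
  one_mem' := by simp
  mul_mem' {g g'} hg hg' := fun h hh => by
    have e : ((g * g' : GroupLike k H) : H) * h * (((g * g')⁻¹ : GroupLike k H) : H) =
        (g : H) * ((g' : H) * h * ((g'⁻¹ : GroupLike k H) : H)) *
          ((g⁻¹ : GroupLike k H) : H) := by
      rw [mul_inv_rev, GroupLike.val_mul, GroupLike.val_mul]; simp only [mul_assoc]
    rw [e, hg' h hh, hg h hh]
  inv_mem' {g} hg := fun h hh => by
    have e : ((g⁻¹ : GroupLike k H) : H) * (g : H) = 1 := by
      rw [← GroupLike.val_mul, inv_mul_cancel, GroupLike.val_one]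
    calc ((g⁻¹ : GroupLike k H) : H) * h * ((g⁻¹⁻¹ : GroupLike k H) : H)
        = ((g⁻¹ : GroupLike k H) : H) * ((g : H) * h * ((g⁻¹ : GroupLike k H) : H)) * (g : H) := by
          rw [hg h hh, inv_inv]
      _ = (((g⁻¹ : GroupLike k H) : H) * (g : H)) * h *
            (((g⁻¹ : GroupLike k H) : H) * (g : H)) := by simp only [mul_assoc]
      _ = h := by rw [e, one_mul, mul_one]

variable {k H} in
/-- The index `a_x = |⟨x⟩ : C_{⟨x⟩}(P_{x,1}(H))|`, as a natural number with the value `0` standing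
for an infinite index. -/
def centralizerIndex (x : GroupLike k H) : ℕ :=
  (conjCentralizer (skewPrimitive x 1)).relIndex (Subgroup.zpowers x)

/-- The invariant `m_H = lcm {a_x : x ∈ G(H)}`: the least positive integer divisible by all the
`a_x`, or `∞` if there is none (in particular, if some `a_x` is infinite). -/
def mInvariant : ℕ∞ :=
  sInf ((fun n : ℕ => (n : ℕ∞)) '' {n | 0 < n ∧ ∀ x : GroupLike k H, centralizerIndex x ∣ n})

/-- The order `|S|` of the antipode: the least `n ≥ 1` with `S ^ n = id`, or `∞` if there is
none. -/
def antipodeOrder : ℕ∞ :=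
  sInf ((fun n : ℕ => (n : ℕ∞)) '' {n | 0 < n ∧ (antipode k : Module.End k H) ^ n = 1})

end Invariants

end Hopf

end PointedHopf

end

open PointedHopf

/-!
The square `S ^ 2` of the antipode fixes the group-like elements and acts on `P_{x,1}(H)` as
conjugation by `x`. Hence `a_x ∣ n` if and only if `S ^ (2 n)` is the identity on `P_{x,1}(H)`
(`centralizerIndex_dvd_iff`). In particular `S ^ N = id` makes all `a_x` divide `N`, so that `m_H`
is finite.

Let `m = m_H` be finite and `T = S ^ (2 m)`, a bialgebra endomorphism. Since `H_1` is spanned by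
group-like and skew-primitive elements (`coradFilt_one_le`), `T` is the identity on `H_1`. A
coalgebra endomorphism with this property acts trivially on all the quotients `H_n / H_{n-1}`, by
induction on `n` and the inclusion `Δ(H_n) ⊆ ∑ H_i ⊗ H_{n-i}` (`map_sub_mem_coradFilt`).

In characteristic zero an operator of finite order acting trivially on the quotients of an
exhaustive filtration is the identity. The coradical filtration is exhaustive
(`exists_mem_coradFilt`), so `S ^ (2 m) = id` as soon as `S` has finite order, and then
`|S| = 2 m` unless `S` is the identity: an odd power of `S` reverses products, so an odd order makes `H`
commutative and `m = 1`. The same argument for `gr H` needs `m_H = m_{gr H}`, where the inequality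
`≤` holds because an operator of finite order on `P_{x,1}(H)` that is trivial modulo `H_0`, and on
`H_0`, is trivial (`centralizerIndex_dvd_of_gr`).

In characteristic `p`, the operator `T - 1` kills `H_1` and lowers the filtration degree, so
`T ^ (p ^ l) - 1 = (T - 1) ^ (p ^ l)` vanishes on `H_n` if `p ^ l ≥ n`; if `H_n` generates `H`, the
algebra endomorphism `T ^ (p ^ l)` is the identity.

Everything on coalgebras is done with the two commuting actions of functionals, `c ↦ ∑ f(c₁) c₂`
(`leftHit`) and `c ↦ ∑ f(c₂) c₁` (`rightHit`).
-/

noncomputable section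

namespace PointedHopf

/-! ### The actions of functionals on a coalgebra -/

section Contraction

variable {k C : Type*} [Field k] [AddCommGroup C] [Module k C]

/-- The contraction `a ⊗ b ↦ f(a) b` of the left tensor factor. -/
def leftContract (f : C →ₗ[k] k) : C ⊗[k] C →ₗ[k] C :=
  (TensorProduct.lid k C).toLinearMap ∘ₗ f.rTensor C

/-- The contraction `a ⊗ b ↦ f(b) a` of the right tensor factor. -/
def rightContract (f : C →ₗ[k] k) : C ⊗[k] C →ₗ[k] C :=
  (TensorProduct.rid k C).toLinearMap ∘ₗ f.lTensor C

@[simp]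
lemma leftContract_tmul (f : C →ₗ[k] k) (a b : C) : leftContract f (a ⊗ₜ[k] b) = f a • b := by
  simp [leftContract]

@[simp]
lemma rightContract_tmul (f : C →ₗ[k] k) (a b : C) : rightContract f (a ⊗ₜ[k] b) = f b • a := by
  simp [rightContract]

lemma leftContract_mem {U V : Submodule k C} {t : C ⊗[k] C} (ht : t ∈ tensorSub U V)
    (f : C →ₗ[k] k) : leftContract f t ∈ V :=
  (tensorSub_le (P := V.comap (leftContract f)) fun a _ b hb => by
    simpa using V.smul_mem _ hb) ht

lemma rightContract_mem {U V : Submodule k C} {t : C ⊗[k] C} (ht : t ∈ tensorSub U V)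
    (f : C →ₗ[k] k) : rightContract f t ∈ U :=
  (tensorSub_le (P := U.comap (rightContract f)) fun a ha b _ => by
    simpa using U.smul_mem _ ha) ht

/-- Membership in `C ⊗ V` is detected by contracting the left tensor factor. -/
lemma mem_tensorSub_top_left {V : Submodule k C} {t : C ⊗[k] C}
    (h : ∀ f : C →ₗ[k] k, leftContract f t ∈ V) : t ∈ tensorSub ⊤ V := by
  classical
  obtain ⟨c, rfl⟩ := TensorProduct.eq_repr_basis_left (Module.Basis.ofVectorSpace k C) t
  refine Submodule.sum_mem _ fun i _ => tmul_mem_tensorSub Submodule.mem_top ?_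
  have := h ((Module.Basis.ofVectorSpace k C).coord i)
  rw [Finsupp.sum, map_sum, Finset.sum_eq_single i] at this
  · simpa [-Module.Basis.coe_ofVectorSpace] using this
  · intro j _ hj
    simp [-Module.Basis.coe_ofVectorSpace, Finsupp.single_eq_of_ne' hj]
  · intro hi
    simp [Finsupp.notMem_support_iff.1 hi]

/-- Membership in `U ⊗ C` is detected by contracting the right tensor factor. -/
lemma mem_tensorSub_top_right {U : Submodule k C} {t : C ⊗[k] C}
    (h : ∀ f : C →ₗ[k] k, rightContract f t ∈ U) : t ∈ tensorSub U ⊤ := by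
  classical
  obtain ⟨c, rfl⟩ := TensorProduct.eq_repr_basis_right (Module.Basis.ofVectorSpace k C) t
  refine Submodule.sum_mem _ fun i _ => tmul_mem_tensorSub ?_ Submodule.mem_top
  have := h ((Module.Basis.ofVectorSpace k C).coord i)
  rw [Finsupp.sum, map_sum, Finset.sum_eq_single i] at this
  · simpa [-Module.Basis.coe_ofVectorSpace] using this
  · intro j _ hj
    simp [-Module.Basis.coe_ofVectorSpace, Finsupp.single_eq_of_ne' hj]
  · intro hi
    simp [Finsupp.notMem_support_iff.1 hi]

variable [Coalgebra k C]

/-- The operator `c ↦ ∑ f(c₁) c₂` on a coalgebra. -/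
def leftHit (f : C →ₗ[k] k) : C →ₗ[k] C := leftContract f ∘ₗ comul

/-- The operator `c ↦ ∑ f(c₂) c₁` on a coalgebra. -/
def rightHit (f : C →ₗ[k] k) : C →ₗ[k] C := rightContract f ∘ₗ comul

lemma leftHit_apply (f : C →ₗ[k] k) (c : C) : leftHit f c = leftContract f (comul c) := rfl

lemma rightHit_apply (f : C →ₗ[k] k) (c : C) : rightHit f c = rightContract f (comul c) := rfl

@[simp]
lemma leftHit_counit (c : C) : leftHit (counit (R := k)) c = c := by
  simp [leftHit, leftContract]

@[simp]
lemma rightHit_counit (c : C) : rightHit (counit (R := k)) c = c := by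
  simp [rightHit, rightContract]

lemma leftHit_groupLike (f : C →ₗ[k] k) (g : GroupLike k C) :
    leftHit f (g : C) = f (g : C) • (g : C) := by
  simp [leftHit_apply]

lemma rightHit_groupLike (f : C →ₗ[k] k) (g : GroupLike k C) :
    rightHit f (g : C) = f (g : C) • (g : C) := by
  simp [rightHit_apply]

lemma counit_rightHit (f : C →ₗ[k] k) (c : C) : counit (R := k) (rightHit f c) = f c := by
  have e : (counit (R := k) (A := C)) ∘ₗ rightContract f = f ∘ₗ leftContract counit :=
    TensorProduct.ext' fun a b => by simp [mul_comm]
  exact (LinearMap.congr_fun e (comul c)).trans (congrArg f (leftHit_counit c))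

lemma comul_leftHit (f : C →ₗ[k] k) (c : C) :
    comul (leftHit f c) = (leftHit f).rTensor C (comul (R := k) c) := by
  have e1 : comul ∘ₗ leftContract f = (TensorProduct.lid k _).toLinearMap ∘ₗ
      f.rTensor (C ⊗[k] C) ∘ₗ (comul (R := k) (A := C)).lTensor C :=
    TensorProduct.ext' fun a b => by simp
  have e2 : (TensorProduct.lid k _).toLinearMap ∘ₗ f.rTensor (C ⊗[k] C) ∘ₗ
      (TensorProduct.assoc k C C C).toLinearMap = (leftContract f).rTensor C := by
    ext; simp [TensorProduct.smul_tmul']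
  rw [leftHit_apply, leftHit, LinearMap.rTensor_comp, LinearMap.comp_apply, ← e2]
  refine (LinearMap.congr_fun e1 (comul c)).trans ?_
  simp only [LinearMap.comp_apply, LinearEquiv.coe_coe]
  rw [coassoc_apply]

lemma comul_rightHit (f : C →ₗ[k] k) (c : C) :
    comul (rightHit f c) = (rightHit f).lTensor C (comul (R := k) c) := by
  have e1 : comul ∘ₗ rightContract f = (TensorProduct.rid k _).toLinearMap ∘ₗ
      f.lTensor (C ⊗[k] C) ∘ₗ (comul (R := k) (A := C)).rTensor C :=
    TensorProduct.ext' fun a b => by simp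
  have e2 : (TensorProduct.rid k _).toLinearMap ∘ₗ f.lTensor (C ⊗[k] C) =
      (rightContract f).lTensor C ∘ₗ (TensorProduct.assoc k C C C).toLinearMap := by
    ext; simp
  rw [rightHit_apply, rightHit, LinearMap.lTensor_comp, LinearMap.comp_apply, ← coassoc_apply]
  refine (LinearMap.congr_fun e1 (comul c)).trans ?_
  exact LinearMap.congr_fun e2 _

lemma leftHit_leftHit (f g : C →ₗ[k] k) (c : C) :
    leftHit f (leftHit g c) = leftHit (f ∘ₗ leftHit g) c := by
  rw [leftHit_apply, comul_leftHit, leftHit_apply]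
  generalize comul (R := k) c = t
  exact LinearMap.congr_fun (f := leftContract f ∘ₗ (leftHit g).rTensor C)
    (TensorProduct.ext' fun a b => by simp) t

lemma rightHit_rightHit (f g : C →ₗ[k] k) (c : C) :
    rightHit f (rightHit g c) = rightHit (f ∘ₗ rightHit g) c := by
  rw [rightHit_apply, comul_rightHit, rightHit_apply]
  generalize comul (R := k) c = t
  exact LinearMap.congr_fun (f := rightContract f ∘ₗ (rightHit g).lTensor C)
    (TensorProduct.ext' fun a b => by simp) t

lemma rightHit_leftHit (f g : C →ₗ[k] k) (c : C) :
    rightHit f (leftHit g c) = leftHit g (rightHit f c) := by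
  rw [rightHit_apply, comul_leftHit, rightHit_apply]
  generalize comul (R := k) c = t
  exact LinearMap.congr_fun (f := rightContract f ∘ₗ (leftHit g).rTensor C)
    (g := leftHit g ∘ₗ rightContract f) (TensorProduct.ext' fun a b => by simp) t

lemma IsSubcoalgebra.leftHit_mem {D : Submodule k C} (hD : IsSubcoalgebra D) (f : C →ₗ[k] k)
    {c : C} (hc : c ∈ D) : leftHit f c ∈ D :=
  leftContract_mem (hD c hc) f

lemma IsSubcoalgebra.rightHit_mem {D : Submodule k C} (hD : IsSubcoalgebra D) (f : C →ₗ[k] k)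
    {c : C} (hc : c ∈ D) : rightHit f c ∈ D :=
  rightContract_mem (hD c hc) f

/-- A subspace stable under both actions of the functionals is a subcoalgebra. -/
lemma isSubcoalgebra_of_hit {D : Submodule k C} (hl : ∀ f : C →ₗ[k] k, ∀ c ∈ D, leftHit f c ∈ D)
    (hr : ∀ f : C →ₗ[k] k, ∀ c ∈ D, rightHit f c ∈ D) : IsSubcoalgebra D := fun c hc =>
  tensorSub_inf D D ⟨mem_tensorSub_top_right fun f => hr f c hc,
    mem_tensorSub_top_left fun f => hl f c hc⟩

end Contraction

/-! ### Skew-primitive elements and coalgebra endomorphisms -/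

section TaftWilson

variable {k C : Type*} [Field k] [AddCommGroup C] [Module k C] [Coalgebra k C]

/-- Functionals on `C` restricting to the dual basis of the group-like elements. -/
lemma exists_groupLike_coord : ∃ e : GroupLike k C → C →ₗ[k] k,
    (∀ g, e g (g : C) = 1) ∧ ∀ g h, g ≠ h → e g (h : C) = 0 := by
  classical
  obtain ⟨E, hE⟩ := LinearMap.exists_leftInverse_of_injective
    (Finsupp.linearCombination k (GroupLike.val (R := k) (A := C)))
    (LinearMap.ker_eq_bot.2 linearIndep_groupLikeVal)
  have h1 : ∀ g : GroupLike k C, E (g : C) = Finsupp.single g 1 := fun g => by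
    simpa using LinearMap.congr_fun hE (Finsupp.single g 1)
  exact ⟨fun g => Finsupp.lapply g ∘ₗ E, fun g => by simp [h1],
    fun g h hgh => by simp [h1, Finsupp.single_eq_of_ne hgh]⟩

lemma exists_sum_groupLike_tmul {t : C ⊗[k] C}
    (ht : t ∈ tensorSub (Submodule.span k {g : C | IsGroupLikeElem k g}) ⊤) :
    ∃ v : GroupLike k C →₀ C, t = v.sum fun g c => (g : C) ⊗ₜ[k] c := by
  suffices tensorSub (Submodule.span k {g : C | IsGroupLikeElem k g}) ⊤ ≤ LinearMap.range
      (Finsupp.lsum k fun g : GroupLike k C => TensorProduct.mk k C C (g : C)) by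
    obtain ⟨v, rfl⟩ := this ht
    exact ⟨v, rfl⟩
  refine tensorSub_le fun a ha b _ => ?_
  suffices Submodule.span k {g : C | IsGroupLikeElem k g} ≤ (LinearMap.range
      (Finsupp.lsum k fun g : GroupLike k C => TensorProduct.mk k C C (g : C))).comap
        ((TensorProduct.mk k C C).flip b) from this ha
  exact Submodule.span_le.2 fun g hg => ⟨Finsupp.single ⟨g, hg⟩ b, by simp⟩

lemma exists_sum_tmul_groupLike {t : C ⊗[k] C}
    (ht : t ∈ tensorSub ⊤ (Submodule.span k {g : C | IsGroupLikeElem k g})) :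
    ∃ v : GroupLike k C →₀ C, t = v.sum fun g c => c ⊗ₜ[k] (g : C) := by
  suffices tensorSub ⊤ (Submodule.span k {g : C | IsGroupLikeElem k g}) ≤ LinearMap.range
      (Finsupp.lsum k fun g : GroupLike k C => (TensorProduct.mk k C C).flip (g : C)) by
    obtain ⟨v, rfl⟩ := this ht
    exact ⟨v, rfl⟩
  refine tensorSub_le fun b _ a ha => ?_
  suffices Submodule.span k {g : C | IsGroupLikeElem k g} ≤ (LinearMap.range
      (Finsupp.lsum k fun g : GroupLike k C => (TensorProduct.mk k C C).flip (g : C))).comap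
        (TensorProduct.mk k C C b) from this ha
  exact Submodule.span_le.2 fun g hg => ⟨Finsupp.single ⟨g, hg⟩ b, by simp⟩

/-- If `Δ(c) - c ⊗ h` lies in `kG ⊗ C`, where `G` is the set of group-like elements, then `c` is a
linear combination of `h` and of elements `d` with `Δ(d) = d ⊗ h + g ⊗ d`: the coefficients of
`Δ(c) - c ⊗ h` in the basis `G` have this form by coassociativity. -/
lemma mem_of_comul_sub_tmul_mem {M : Submodule k C} (hG : ∀ g : GroupLike k C, (g : C) ∈ M)
    (hP : ∀ g x : GroupLike k C, ∀ d : C,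
      comul d = d ⊗ₜ[k] (x : C) + (g : C) ⊗ₜ[k] d → d ∈ M)
    {c : C} {h : GroupLike k C} (hc : comul c - c ⊗ₜ[k] (h : C) ∈
      tensorSub (Submodule.span k {g : C | IsGroupLikeElem k g}) ⊤) : c ∈ M := by
  classical
  obtain ⟨e, he, he'⟩ := exists_groupLike_coord (k := k) (C := C)
  obtain ⟨v, hv⟩ := exists_sum_groupLike_tmul hc
  rw [sub_eq_iff_eq_add] at hv
  have hcoord : ∀ g, leftHit (e g) c = v g + e g c • (h : C) := fun g => by
    rw [leftHit_apply, hv, map_add, leftContract_tmul, Finsupp.sum, map_sum,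
      Finset.sum_eq_single g]
    · simp [he]
    · intro g' _ hg'
      simp [he' g g' hg'.symm]
    · intro hg
      simp [Finsupp.notMem_support_iff.1 hg]
  have hvP : ∀ g, v g ∈ M := fun g => by
    refine hP g h _ ?_
    have h1 := comul_leftHit (e g) c
    rw [hcoord, hv, map_add, map_add, LinearMap.rTensor_tmul, hcoord, Finsupp.sum, map_sum,
      Finset.sum_eq_single g] at h1
    · rw [LinearMap.rTensor_tmul, leftHit_groupLike, he, one_smul, map_smul,
        h.isGroupLikeElem_val.comul_eq_tmul_self, TensorProduct.add_tmul,
        TensorProduct.smul_tmul', ← add_assoc] at h1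
      rw [add_right_cancel h1, add_comm]
    · intro g' _ hg'
      rw [LinearMap.rTensor_tmul, leftHit_groupLike, he' g g' hg'.symm, zero_smul,
        TensorProduct.zero_tmul]
    · intro hg
      simp [Finsupp.notMem_support_iff.1 hg]
  have hε := leftHit_counit (k := k) c
  rw [leftHit_apply, hv, map_add, leftContract_tmul, Finsupp.sum, map_sum] at hε
  rw [← hε]
  refine add_mem (Submodule.sum_mem _ fun g _ => ?_) (M.smul_mem _ (hG h))
  rw [leftContract_tmul]
  exact M.smul_mem _ (hvP g)

/-- The first term of the coradical filtration of a pointed coalgebra is spanned by group-like and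
skew-primitive elements (Taft and Wilson). -/
lemma coradFilt_one_le [IsPointed k C] {M : Submodule k C}
    (hG : ∀ g : GroupLike k C, (g : C) ∈ M)
    (hP : ∀ g x : GroupLike k C, ∀ d : C,
      comul d = d ⊗ₜ[k] (x : C) + (g : C) ⊗ₜ[k] d → d ∈ M) :
    coradFilt k C 1 ≤ M := by
  classical
  intro c hc
  obtain ⟨e, he, he'⟩ := exists_groupLike_coord (k := k) (C := C)
  have h0 : coradical k C = Submodule.span k {g : C | IsGroupLikeElem k g} :=
    IsPointed.coradical_eq
  have h0M : coradical k C ≤ M := h0 ▸ Submodule.span_le.2 fun g hg => hG ⟨g, hg⟩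
  obtain ⟨s, hs, t, ht, hst⟩ := Submodule.mem_sup.1
    (show comul c ∈ tensorSub ⊤ (coradical k C) ⊔ tensorSub (coradical k C) ⊤ from hc)
  rw [h0] at hs
  obtain ⟨u, rfl⟩ := exists_sum_tmul_groupLike hs
  have huM : ∀ h, u h ∈ M := fun h => by
    refine mem_of_comul_sub_tmul_mem hG hP (h := h) ?_
    rw [← h0]
    have h1 := comul_rightHit (e h) c
    have h2 : rightHit (e h) c = u h + rightContract (e h) t := by
      rw [rightHit_apply, ← hst, map_add, Finsupp.sum, map_sum, Finset.sum_eq_single h]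
      · simp [he]
      · intro g' _ hg'
        simp [he' h g' hg'.symm]
      · intro hg
        simp [Finsupp.notMem_support_iff.1 hg]
    have h3 : (rightHit (e h)).lTensor C (comul (R := k) c) =
        u h ⊗ₜ[k] (h : C) + (rightHit (e h)).lTensor C t := by
      rw [← hst, map_add, Finsupp.sum, map_sum, Finset.sum_eq_single h]
      · rw [LinearMap.lTensor_tmul, rightHit_groupLike, he, one_smul]
      · intro g' _ hg'
        rw [LinearMap.lTensor_tmul, rightHit_groupLike, he' h g' hg'.symm, zero_smul,
          TensorProduct.tmul_zero]
      · intro hg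
        simp [Finsupp.notMem_support_iff.1 hg]
    rw [h2, h3, map_add, ← sub_eq_zero] at h1
    have h4 : comul (u h) - u h ⊗ₜ[k] (h : C) =
        (rightHit (e h)).lTensor C t - comul (rightContract (e h) t) := by
      rw [← sub_eq_zero, ← h1]; abel
    rw [h4]
    refine sub_mem ?_ ?_
    · exact (tensorSub_le (P := (tensorSub (coradical k C) ⊤).comap ((rightHit (e h)).lTensor C))
        fun a ha b _ => tmul_mem_tensorSub ha Submodule.mem_top) ht
    · exact tensorSub_mono le_rfl le_top
        (isSubcoalgebra_coradical k C _ (rightContract_mem ht _))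
  have hε := rightHit_counit (k := k) c
  rw [rightHit_apply, ← hst, map_add, Finsupp.sum, map_sum] at hε
  rw [← hε]
  refine add_mem (Submodule.sum_mem _ fun g _ => ?_) (h0M (rightContract_mem ht _))
  rw [rightContract_tmul]
  exact M.smul_mem _ (huM g)

/-- A coalgebra endomorphism fixing `C_1` pointwise induces the identity on the quotients
`C_{n+1} / C_n`, because `C_{n+1} / C_n` embeds in `C_1 / C_0 ⊗ C_n / C_{n-1}`. -/
lemma map_sub_mem_coradFilt {φ : C →ₗ[k] C}
    (hφ : ∀ c, comul (φ c) = TensorProduct.map φ φ (comul (R := k) c))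
    (h1 : ∀ c ∈ coradFilt k C 1, φ c = c) (n : ℕ) :
    ∀ c ∈ coradFilt k C (n + 1), φ c - c ∈ coradFilt k C n := by
  induction n with
  | zero => intro c hc; rw [h1 c hc, sub_self]; exact zero_mem _
  | succ n ih =>
    intro c hc
    change comul (φ c - c) ∈ tensorSub ⊤ (coradFilt k C n) ⊔ tensorSub (coradical k C) ⊤
    rw [map_sub, hφ]
    refine (tensorFilt_le (P := (tensorSub ⊤ (coradFilt k C n) ⊔
      tensorSub (coradical k C) ⊤).comap (TensorProduct.map φ φ - LinearMap.id))
      fun i j hij a ha b hb => ?_) (comul_mem_tensorFilt hc)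
    change φ a ⊗ₜ[k] φ b - a ⊗ₜ[k] b ∈
      tensorSub ⊤ (coradFilt k C n) ⊔ tensorSub (coradical k C) ⊤
    have hφn : ∀ b ∈ coradFilt k C n, φ b ∈ coradFilt k C n := fun b hb => by
      have := ih b (coradFilt_mono k C n.le_succ hb)
      exact (sub_add_cancel (φ b) b) ▸ add_mem this hb
    rcases i with _ | _ | i
    · rw [h1 a (coradFilt_mono k C zero_le_one ha)]
      exact Submodule.mem_sup_right
        (sub_mem (tmul_mem_tensorSub ha Submodule.mem_top)
          (tmul_mem_tensorSub ha Submodule.mem_top))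
    · rw [h1 a ha, ← TensorProduct.tmul_sub]
      refine Submodule.mem_sup_left (tmul_mem_tensorSub Submodule.mem_top (ih b ?_))
      rwa [show n + 1 = j by omega]
    · have hb' : b ∈ coradFilt k C n := coradFilt_mono k C (show j ≤ n by omega) hb
      exact Submodule.mem_sup_left (sub_mem (tmul_mem_tensorSub Submodule.mem_top (hφn b hb'))
        (tmul_mem_tensorSub Submodule.mem_top hb'))

end TaftWilson

/-! ### The coradical filtration is exhaustive -/

section Exhaustive

variable {k C : Type*} [Field k] [AddCommGroup C] [Module k C]

lemma exists_finite_mem_tensorSub (t : C ⊗[k] C) :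
    ∃ U : Submodule k C, FiniteDimensional k U ∧ t ∈ tensorSub U U := by
  induction t with
  | zero => exact ⟨⊥, inferInstance, zero_mem _⟩
  | tmul a b =>
    refine ⟨k ∙ a ⊔ k ∙ b, inferInstance, tmul_mem_tensorSub ?_ ?_⟩
    · exact Submodule.mem_sup_left (Submodule.mem_span_singleton_self a)
    · exact Submodule.mem_sup_right (Submodule.mem_span_singleton_self b)
  | add x y hx hy =>
    obtain ⟨U, _, hU⟩ := hx
    obtain ⟨V, _, hV⟩ := hy
    exact ⟨U ⊔ V, inferInstance, add_mem (tensorSub_mono le_sup_left le_sup_left hU)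
      (tensorSub_mono le_sup_right le_sup_right hV)⟩

variable [Coalgebra k C]

lemma exists_finite_comul_mem (V : Submodule k C) [FiniteDimensional k V] :
    ∃ U : Submodule k C, FiniteDimensional k U ∧ ∀ v ∈ V, comul (R := k) v ∈ tensorSub U U := by
  refine Submodule.fg_induction (motive := fun V _ => ∃ U : Submodule k C,
    FiniteDimensional k U ∧ ∀ v ∈ V, comul (R := k) v ∈ tensorSub U U) (fun x => ?_)
    (fun V W _ _ hV hW => ?_) V (Module.Finite.iff_fg.1 (inferInstance : FiniteDimensional k V))
  · obtain ⟨U, hf, hU⟩ := exists_finite_mem_tensorSub (comul (R := k) x)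
    refine ⟨U, hf, fun v hv => ?_⟩
    obtain ⟨r, rfl⟩ := Submodule.mem_span_singleton.1 hv
    rw [map_smul]
    exact Submodule.smul_mem _ r hU
  · obtain ⟨U, _, hU⟩ := hV
    obtain ⟨U', _, hU'⟩ := hW
    refine ⟨U ⊔ U', inferInstance, fun v hv => ?_⟩
    obtain ⟨x, hx, y, hy, rfl⟩ := Submodule.mem_sup.1 hv
    rw [map_add]
    exact add_mem (tensorSub_mono le_sup_left le_sup_left (hU x hx))
      (tensorSub_mono le_sup_right le_sup_right (hU' y hy))

/-- The left coideal `{∑ f(c₁) c₂ | f ∈ C*}` generated by `c`. -/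
def leftOrbit (c : C) : Submodule k C where
  carrier := {d | ∃ f : C →ₗ[k] k, leftHit f c = d}
  zero_mem' := ⟨0, by simp [leftHit, leftContract]⟩
  add_mem' := by
    rintro _ _ ⟨f, rfl⟩ ⟨g, rfl⟩
    exact ⟨f + g, by simp [leftHit, leftContract, LinearMap.rTensor_add]⟩
  smul_mem' := by
    rintro r _ ⟨f, rfl⟩
    exact ⟨r • f, by simp [leftHit, leftContract, LinearMap.rTensor_smul]⟩

lemma self_mem_leftOrbit (c : C) : c ∈ leftOrbit (k := k) c := ⟨counit, leftHit_counit c⟩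

lemma leftHit_mem_leftOrbit (f : C →ₗ[k] k) {c d : C} (hd : d ∈ leftOrbit (k := k) c) :
    leftHit f d ∈ leftOrbit (k := k) c := by
  obtain ⟨g, rfl⟩ := hd
  exact ⟨_, (leftHit_leftHit f g c).symm⟩

/-- The fundamental theorem of coalgebras: every element lies in a finite-dimensional
subcoalgebra. -/
lemma exists_finite_subcoalgebra (c : C) :
    ∃ D : Submodule k C, FiniteDimensional k D ∧ IsSubcoalgebra D ∧ c ∈ D := by
  obtain ⟨U, _, hU⟩ := exists_finite_mem_tensorSub (comul (R := k) c)
  obtain ⟨V, _, hV⟩ := exists_finite_comul_mem U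
  let s : Set C := {d | ∃ f : C →ₗ[k] k, ∃ b ∈ leftOrbit (k := k) c, rightHit f b = d}
  have hs : Submodule.span k s ≤ V := Submodule.span_le.2 <| by
    rintro _ ⟨f, b, ⟨g, rfl⟩, rfl⟩
    exact rightContract_mem (hV _ (leftContract_mem hU g)) f
  refine ⟨Submodule.span k s, Submodule.finiteDimensional_of_le hs,
    isSubcoalgebra_of_hit (fun f => ?_) (fun f => ?_),
    Submodule.subset_span ⟨counit, c, self_mem_leftOrbit c, rightHit_counit c⟩⟩
  · refine (Submodule.span_le (p := (Submodule.span k s).comap (leftHit f))).2 ?_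
    rintro _ ⟨g, b, hb, rfl⟩
    exact Submodule.subset_span ⟨g, _, leftHit_mem_leftOrbit f hb, rightHit_leftHit g f b⟩
  · refine (Submodule.span_le (p := (Submodule.span k s).comap (rightHit f))).2 ?_
    rintro _ ⟨g, b, hb, rfl⟩
    exact Submodule.subset_span ⟨_, b, hb, (rightHit_rightHit f g b).symm⟩

lemma exists_groupLike_mem_of_le {D : Submodule k C} (hD : IsSubcoalgebra D) (h0 : D ≠ ⊥)
    (hle : D ≤ Submodule.span k {g : C | IsGroupLikeElem k g}) :
    ∃ g : GroupLike k C, (g : C) ∈ D := by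
  classical
  obtain ⟨e, he, he'⟩ := exists_groupLike_coord (k := k) (C := C)
  obtain ⟨c, hc, hc0⟩ := Submodule.exists_mem_ne_zero_of_ne_bot h0
  have hr : Set.range (GroupLike.val (R := k) (A := C)) = {g : C | IsGroupLikeElem k g} := by
    ext g
    exact ⟨by rintro ⟨g, rfl⟩; exact g.2, fun hg => ⟨⟨g, hg⟩, rfl⟩⟩
  have hc' := hle hc
  rw [← hr, Finsupp.mem_span_range_iff_exists_finsupp] at hc'
  obtain ⟨a, rfl⟩ := hc'
  obtain ⟨g, hg⟩ : ∃ g, a g ≠ 0 := by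
    by_contra! h
    exact hc0 (Finset.sum_eq_zero fun g _ => by simp [h g])
  refine ⟨g, ?_⟩
  have h1 := hD.rightHit_mem (e g) hc
  rw [Finsupp.sum, map_sum, Finset.sum_eq_single g] at h1
  · rw [map_smul, rightHit_groupLike, he, one_smul] at h1
    exact (Submodule.smul_mem_iff _ hg).1 h1
  · intro g' _ hg'
    rw [map_smul, rightHit_groupLike, he' g g' hg'.symm, zero_smul, smul_zero]
  · intro hg
    simp [Finsupp.notMem_support_iff.1 hg]

lemma exists_groupLike_mem [IsPointed k C] (D : Submodule k C) [FiniteDimensional k D]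
    (hD : IsSubcoalgebra D) (h0 : D ≠ ⊥) : ∃ g : GroupLike k C, (g : C) ∈ D := by
  obtain ⟨n, hn⟩ : ∃ n, Module.finrank k D = n := ⟨_, rfl⟩
  induction n using Nat.strong_induction_on generalizing D with
  | _ n ih =>
    by_cases hs : IsSimpleSubcoalgebra D
    · refine exists_groupLike_mem_of_le hD h0 ?_
      rw [← IsPointed.coradical_eq (k := k) (C := C)]
      exact le_sSup hs
    · simp only [IsSimpleSubcoalgebra, not_and, not_forall] at hs
      obtain ⟨E, hE, hED, hne⟩ := hs hD h0
      push Not at hne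
      have : FiniteDimensional k E := Submodule.finiteDimensional_of_le hED
      obtain ⟨g, hg⟩ := ih _ (hn ▸ Submodule.finrank_lt_finrank_of_lt (hED.lt_of_ne hne.2)) E hE
        hne.1 rfl
      exact ⟨g, hED hg⟩

lemma rightHit_eq_zero {E : Submodule k C} (hE : IsSubcoalgebra E) {f : C →ₗ[k] k}
    (hf : ∀ x ∈ E, f x = 0) {c : C} (hc : c ∈ E) : rightHit f c = 0 :=
  (tensorSub_le (P := LinearMap.ker (rightContract f)) fun a _ b hb => by
    rw [LinearMap.mem_ker, rightContract_tmul, hf b hb, zero_smul]) (hE c hc)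

lemma exists_minimal_leftStable {E D : Submodule k C} [FiniteDimensional k D] (hED : E < D)
    (hD : ∀ f : C →ₗ[k] k, ∀ c ∈ D, leftHit f c ∈ D) :
    ∃ W : Submodule k C, E < W ∧ W ≤ D ∧ (∀ f : C →ₗ[k] k, ∀ c ∈ W, leftHit f c ∈ W) ∧
      ∀ V : Submodule k C, E < V → V ≤ W → (∀ f : C →ₗ[k] k, ∀ c ∈ V, leftHit f c ∈ V) →
        V = W := by
  obtain ⟨W, ⟨h1, h2, h3⟩, hmin⟩ := (measure fun W : Submodule k C => Module.finrank k W).wf.has_min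
    {W | E < W ∧ W ≤ D ∧ ∀ f : C →ₗ[k] k, ∀ c ∈ W, leftHit f c ∈ W} ⟨D, hED, le_rfl, hD⟩
  refine ⟨W, h1, h2, h3, fun V hV hVW hV' => ?_⟩
  have : FiniteDimensional k W := Submodule.finiteDimensional_of_le h2
  exact Submodule.eq_of_le_of_finrank_le hVW
    (not_lt.1 (hmin V ⟨hV, hVW.trans h2, hV'⟩))

/-- A nonzero quotient `D / E` of finite-dimensional subcoalgebras of a pointed coalgebra contains
a one-dimensional left subcomodule. A minimal left subcomodule `W / E` has this property: its
matrix coefficients `∑ ξ(w₂) w₁`, with `ξ` vanishing on `E`, span a subcoalgebra, which contains a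
group-like element `g`, and by minimality `W / E` is isomorphic to the comodule `k g`. -/
lemma exists_comul_mem_of_lt [IsPointed k C] {E D : Submodule k C} [FiniteDimensional k D]
    (hE : IsSubcoalgebra E) (hD : IsSubcoalgebra D) (hED : E < D) :
    ∃ w ∈ D, w ∉ E ∧ comul (R := k) w ∈ tensorSub ⊤ E ⊔ tensorSub (coradical k C) ⊤ := by
  obtain ⟨W, hEW, hWD, hW, hmin⟩ := exists_minimal_leftStable hED fun f c hc => hD.leftHit_mem f hc
  let s : Set C := {d | ∃ ξ : C →ₗ[k] k, (∀ x ∈ E, ξ x = 0) ∧ ∃ w ∈ W, rightHit ξ w = d}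
  have hsD : Submodule.span k s ≤ D := Submodule.span_le.2 <| by
    rintro _ ⟨ξ, _, w, hw, rfl⟩
    exact hD.rightHit_mem ξ (hWD hw)
  have hsub : IsSubcoalgebra (Submodule.span k s) := by
    refine isSubcoalgebra_of_hit (fun f => ?_) (fun f => ?_)
    · refine (Submodule.span_le (p := (Submodule.span k s).comap (leftHit f))).2 ?_
      rintro _ ⟨ξ, hξ, w, hw, rfl⟩
      exact Submodule.subset_span ⟨ξ, hξ, _, hW f w hw, rightHit_leftHit ξ f w⟩
    · refine (Submodule.span_le (p := (Submodule.span k s).comap (rightHit f))).2 ?_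
      rintro _ ⟨ξ, hξ, w, hw, rfl⟩
      refine Submodule.subset_span ⟨f ∘ₗ rightHit ξ, fun x hx => ?_, w, hw,
        (rightHit_rightHit f ξ w).symm⟩
      rw [LinearMap.comp_apply, rightHit_eq_zero hE hξ hx, map_zero]
  have hne : Submodule.span k s ≠ ⊥ := by
    obtain ⟨w, hw, hwE⟩ := SetLike.exists_of_lt hEW
    obtain ⟨ξ, hξw, hξ⟩ := Submodule.exists_le_ker_of_notMem hwE
    intro h
    have h1 : rightHit ξ w ∈ Submodule.span k s :=
      Submodule.subset_span ⟨ξ, fun x hx => hξ hx, w, hw, rfl⟩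
    rw [h, Submodule.mem_bot] at h1
    have h2 := counit_rightHit ξ w
    rw [h1, map_zero] at h2
    exact hξw h2.symm
  have : FiniteDimensional k (Submodule.span k s) := Submodule.finiteDimensional_of_le hsD
  obtain ⟨g, hg⟩ := exists_groupLike_mem _ hsub hne
  -- Choose an expression of `g` by matrix coefficients of least length `r`.
  let P : ℕ → Prop := fun r => ∃ (ξ : Fin r → C →ₗ[k] k) (w : Fin r → C),
    (∀ i, ∀ x ∈ E, ξ i x = 0) ∧ (∀ i, w i ∈ W) ∧ ∑ i, rightHit (ξ i) (w i) = (g : C)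
  have hP : ∃ r, P r := by
    obtain ⟨r, a, v, hv⟩ := Submodule.mem_span_set'.1 hg
    choose ξ hξ w hw hwv using fun i => (v i).2
    exact ⟨r, ξ, fun i => a i • w i, hξ, fun i => W.smul_mem _ (hw i), by simp [hwv, hv]⟩
  classical
  obtain ⟨r, hr, hrmin⟩ : ∃ r, P r ∧ ∀ r' < r, ¬ P r' :=
    ⟨Nat.find hP, Nat.find_spec hP, fun r' => Nat.find_min hP⟩
  obtain ⟨ξ, w, hξ, hw, hsum⟩ := hr
  obtain _ | r := r
  · exact absurd (by simpa using hsum.symm) g.isGroupLikeElem_val.ne_zero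
  have hw0 : w 0 ∉ E := fun h => hrmin r r.lt_succ_self
    ⟨fun i => ξ i.succ, fun i => w i.succ, fun i => hξ _, fun i => hw _, by
      rw [← hsum, Fin.sum_univ_succ, rightHit_eq_zero hE (hξ 0) h, zero_add]⟩
  -- The functionals killing `g` also kill the class of `w 0`, so `w 0 ↦ g` is an isomorphism.
  have key : ∀ f : C →ₗ[k] k, f (g : C) = 0 → leftHit f (w 0) ∈ E := by
    intro f hf
    by_contra hu
    have hV : E ⊔ leftOrbit (leftHit f (w 0)) = W := by
      refine hmin _ (lt_of_le_of_ne le_sup_left fun h => hu ?_) (sup_le hEW.le ?_) fun a c hc => ?_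
      · rw [h]
        exact Submodule.mem_sup_right (self_mem_leftOrbit _)
      · rintro _ ⟨a, rfl⟩
        exact hW a _ (hW f _ (hw 0))
      · obtain ⟨x, hx, y, hy, rfl⟩ := Submodule.mem_sup.1 hc
        rw [map_add]
        exact Submodule.add_mem_sup (hE.leftHit_mem a hx) (leftHit_mem_leftOrbit a hy)
    obtain ⟨x, hx, _, ⟨a, rfl⟩, hxy⟩ := Submodule.mem_sup.1 (hV ▸ hw 0)
    -- Subtracting `leftHit a (leftHit f g) = 0` from `g` shortens the expression of `g`.
    refine hrmin r r.lt_succ_self ⟨fun i => ξ i.succ,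
      fun i => w i.succ - leftHit a (leftHit f (w i.succ)), fun i => hξ _,
      fun i => sub_mem (hw _) (hW a _ (hW f _ (hw _))), ?_⟩
    have h0 : leftHit a (leftHit f (g : C)) = 0 := by
      rw [leftHit_groupLike, hf, zero_smul, map_zero]
    have h1 : ∑ i, rightHit (ξ i) (w i - leftHit a (leftHit f (w i))) = (g : C) := by
      rw [← sub_zero (g : C), ← h0, ← hsum]
      simp only [map_sub, rightHit_leftHit, Finset.sum_sub_distrib, map_sum]
    rw [Fin.sum_univ_succ, ← eq_sub_of_add_eq hxy, rightHit_eq_zero hE (hξ 0) hx, zero_add] at h1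
    exact h1
  refine ⟨w 0, hWD (hw 0), hw0, ?_⟩
  -- Every functional `f` differs from a functional killing `g` by the multiple `f(g) ε` of `ε`.
  rw [← sub_add_cancel (comul (R := k) (w 0)) ((g : C) ⊗ₜ[k] w 0)]
  refine Submodule.add_mem_sup (mem_tensorSub_top_left fun f => ?_)
    (tmul_mem_tensorSub ?_ Submodule.mem_top)
  · have := key (f - f (g : C) • counit) (by simp)
    have e : leftHit (f - f (g : C) • counit) (w 0) = leftHit f (w 0) - f (g : C) • w 0 := by
      conv_rhs => rw [← leftHit_counit (k := k) (w 0)]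
      simp [leftHit, leftContract, LinearMap.rTensor_sub, LinearMap.rTensor_smul]
    rw [e] at this
    simpa [leftHit_apply] using this
  · rw [IsPointed.coradical_eq (k := k) (C := C)]
    exact Submodule.subset_span g.isGroupLikeElem_val

lemma isSubcoalgebra_coradFilt (n : ℕ) : IsSubcoalgebra (coradFilt k C n) := fun _ hc =>
  tensorFilt_le (fun _ _ hij _ ha _ hb => tmul_mem_tensorSub
    (coradFilt_mono k C (by omega) ha) (coradFilt_mono k C (by omega) hb)) (comul_mem_tensorFilt hc)

/-- The coradical filtration of a pointed coalgebra is exhaustive. -/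
lemma exists_mem_coradFilt [IsPointed k C] (c : C) : ∃ n, c ∈ coradFilt k C n := by
  obtain ⟨D, _, hD, hc⟩ := exists_finite_subcoalgebra (k := k) c
  suffices h : ∃ n, D ≤ coradFilt k C n from h.imp fun n hn => hn hc
  by_contra! h
  have hfin : ∀ n, FiniteDimensional k ↥(D ⊓ coradFilt k C n) := fun n =>
    Submodule.finiteDimensional_of_le inf_le_left
  have hstep : ∀ n, D ⊓ coradFilt k C n < D ⊓ coradFilt k C (n + 1) := fun n => by
    have hsub : IsSubcoalgebra (D ⊓ coradFilt k C n) := isSubcoalgebra_of_hit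
      (fun f c hc => ⟨hD.leftHit_mem f hc.1, (isSubcoalgebra_coradFilt n).leftHit_mem f hc.2⟩)
      (fun f c hc => ⟨hD.rightHit_mem f hc.1, (isSubcoalgebra_coradFilt n).rightHit_mem f hc.2⟩)
    obtain ⟨w, hw, hw', hΔ⟩ := exists_comul_mem_of_lt hsub hD
      (inf_le_left.lt_of_ne fun e => h n (inf_eq_left.1 e))
    refine lt_of_le_of_ne (inf_le_inf_left D (coradFilt_mono k C n.le_succ)) fun e => hw' ?_
    rw [e]
    exact ⟨hw, (sup_le_sup_right (tensorSub_mono le_rfl inf_le_right) _ : _ ≤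
      tensorSub ⊤ (coradFilt k C n) ⊔ tensorSub (coradical k C) ⊤) hΔ⟩
  have hrank : ∀ n, n ≤ Module.finrank k ↥(D ⊓ coradFilt k C n) := fun n => by
    induction n with
    | zero => exact Nat.zero_le _
    | succ n ih => exact ih.trans_lt (Submodule.finrank_lt_finrank_of_lt (hstep n))
  have h1 := hrank (Module.finrank k D + 1)
  have h2 := Submodule.finrank_mono (inf_le_left : D ⊓ coradFilt k C (Module.finrank k D + 1) ≤ D)
  omega

end Exhaustive

open HopfAlgebra

/-! ### Even powers of the antipode and the invariant `m_H` -/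

section Antipode

variable {k H : Type*} [Field k] [Ring H] [HopfAlgebra k H]

lemma antipode_pow_mul_apply (j i : ℕ) (h : H) : ((antipode k : Module.End k H) ^ (2 * (j + i))) h =
    ((antipode k : Module.End k H) ^ (2 * j)) (((antipode k : Module.End k H) ^ (2 * i)) h) := by
  rw [mul_add, pow_add, Module.End.mul_apply]

lemma antipode_pow_two_apply (h : H) :
    ((antipode k : Module.End k H) ^ (2 * 1)) h = antipode k (antipode k h) := by
  rw [mul_one, pow_two, Module.End.mul_apply]

lemma antipode_pow_even_mul (j : ℕ) (a b : H) : ((antipode k : Module.End k H) ^ (2 * j)) (a * b) =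
    ((antipode k : Module.End k H) ^ (2 * j)) a * ((antipode k : Module.End k H) ^ (2 * j)) b := by
  induction j generalizing a b with
  | zero => simp
  | succ j ih =>
    simp only [antipode_pow_mul_apply j 1, antipode_pow_two_apply, antipode_mul_antidistrib, ih]

lemma antipode_pow_even_groupLike (j : ℕ) (g : GroupLike k H) :
    ((antipode k : Module.End k H) ^ (2 * j)) (g : H) = (g : H) := by
  induction j with
  | zero => simp
  | succ j ih =>
    rw [antipode_pow_mul_apply j 1, antipode_pow_two_apply,
      g.isGroupLikeElem_val.antipode_antipode, ih]

lemma comul_antipode_pow_even (j : ℕ) (c : H) :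
    comul (((antipode k : Module.End k H) ^ (2 * j)) c) =
      TensorProduct.map ((antipode k : Module.End k H) ^ (2 * j))
        ((antipode k : Module.End k H) ^ (2 * j)) (comul (R := k) c) := by
  induction j generalizing c with
  | zero =>
    rw [mul_zero, pow_zero]
    exact (LinearMap.congr_fun TensorProduct.map_id _).symm
  | succ j ih =>
    have e : TensorProduct.map ((antipode k : Module.End k H) ^ (2 * (j + 1)))
        ((antipode k : Module.End k H) ^ (2 * (j + 1))) =
        TensorProduct.map ((antipode k : Module.End k H) ^ (2 * j))
          ((antipode k : Module.End k H) ^ (2 * j)) ∘ₗ TensorProduct.map (antipode k)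
          (antipode k) ∘ₗ (TensorProduct.comm k H H).toLinearMap ∘ₗ
          TensorProduct.map (antipode k) (antipode k) ∘ₗ
          (TensorProduct.comm k H H).toLinearMap := by
      refine TensorProduct.ext' fun a b => ?_
      simp only [LinearMap.comp_apply, TensorProduct.map_tmul, LinearEquiv.coe_coe,
        TensorProduct.comm_tmul, antipode_pow_mul_apply j 1, antipode_pow_two_apply]
    rw [antipode_pow_mul_apply j 1, antipode_pow_two_apply, ih, comul_antipode, comul_antipode, e]
    rfl

lemma counit_eq_zero_of_mem_skewPrimitive {x : GroupLike k H} {h : H}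
    (hh : h ∈ skewPrimitive x 1) : counit (R := k) h = 0 := by
  have h1 := leftHit_counit (k := k) h
  rw [leftHit_apply, show comul h = h ⊗ₜ[k] (x : H) + ((1 : GroupLike k H) : H) ⊗ₜ[k] h from hh,
    map_add, leftContract_tmul, leftContract_tmul, GroupLike.val_one, Bialgebra.counit_one,
    one_smul, add_eq_right] at h1
  exact (smul_eq_zero.1 h1).resolve_right x.isGroupLikeElem_val.ne_zero

lemma antipode_of_mem_skewPrimitive {x : GroupLike k H} {h : H}
    (hh : h ∈ skewPrimitive x 1) : antipode k h = -(h * ((x⁻¹ : GroupLike k H) : H)) := by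
  have h1 := mul_antipode_rTensor_comul_apply (R := k) h
  rw [counit_eq_zero_of_mem_skewPrimitive hh, map_zero,
    show comul h = h ⊗ₜ[k] (x : H) + ((1 : GroupLike k H) : H) ⊗ₜ[k] h from hh, map_add,
    map_add, LinearMap.rTensor_tmul, LinearMap.rTensor_tmul, LinearMap.mul'_apply,
    LinearMap.mul'_apply, GroupLike.val_one, antipode_one, one_mul] at h1
  rw [← mul_one (antipode k h), ← x.isGroupLikeElem_val.mul_antipode_cancel, ← mul_assoc,
    eq_neg_of_add_eq_zero_left h1, neg_mul, GroupLike.val_inv]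

lemma antipode_antipode_of_mem_skewPrimitive {x : GroupLike k H} {h : H}
    (hh : h ∈ skewPrimitive x 1) :
    antipode k (antipode k h) = (x : H) * h * ((x⁻¹ : GroupLike k H) : H) := by
  rw [antipode_of_mem_skewPrimitive hh, map_neg, antipode_mul_antidistrib,
    antipode_of_mem_skewPrimitive hh, ← GroupLike.val_inv, inv_inv, mul_neg, neg_neg, mul_assoc]

/-- On `P_{x,1}(H)` the map `S ^ 2` is conjugation by `x`. -/
lemma antipode_pow_even_of_mem_skewPrimitive (j : ℕ) {x : GroupLike k H} {h : H}
    (hh : h ∈ skewPrimitive x 1) : ((antipode k : Module.End k H) ^ (2 * j)) h =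
      ((x ^ j : GroupLike k H) : H) * h * (((x ^ j)⁻¹ : GroupLike k H) : H) := by
  induction j with
  | zero => simp
  | succ j ih =>
    rw [antipode_pow_mul_apply j 1, antipode_pow_two_apply,
      antipode_antipode_of_mem_skewPrimitive hh, antipode_pow_even_mul, antipode_pow_even_mul,
      antipode_pow_even_groupLike, antipode_pow_even_groupLike, ih, pow_succ', mul_inv_rev,
      GroupLike.val_mul, GroupLike.val_mul]
    simp only [mul_assoc]

/-- The convention that an infinite index is `0` makes this hold without a finiteness hypothesis. -/
lemma relIndex_zpowers_dvd_iff {G : Type*} [Group G] (K : Subgroup G) (x : G) (n : ℕ) :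
    K.relIndex (Subgroup.zpowers x) ∣ n ↔ x ^ n ∈ K := by
  let z : Subgroup.zpowers x := ⟨x, Subgroup.mem_zpowers x⟩
  have hc : (K.subgroupOf (Subgroup.zpowers x)).Normal := inferInstance
  let q : Subgroup.zpowers x ⧸ K.subgroupOf (Subgroup.zpowers x) := QuotientGroup.mk z
  have htop : ∀ y, y ∈ Subgroup.zpowers q := by
    intro y
    obtain ⟨⟨_, i, rfl⟩, rfl⟩ := QuotientGroup.mk_surjective y
    exact ⟨i, rfl⟩
  have h1 : K.relIndex (Subgroup.zpowers x) = orderOf q := by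
    rw [← Nat.card_zpowers, (Subgroup.eq_top_iff' _).2 htop, Subgroup.card_top]
    rfl
  rw [h1, orderOf_dvd_iff_pow_eq_one]
  change QuotientGroup.mk (z ^ n) = _ ↔ _
  rw [QuotientGroup.eq_one_iff, Subgroup.mem_subgroupOf]
  rfl

/-- The index `a_x` divides `n` if and only if `S ^ (2 n)` is the identity on `P_{x,1}(H)`. -/
lemma centralizerIndex_dvd_iff (x : GroupLike k H) (n : ℕ) : centralizerIndex x ∣ n ↔
    ∀ h ∈ skewPrimitive x 1, ((antipode k : Module.End k H) ^ (2 * n)) h = h := by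
  rw [centralizerIndex, relIndex_zpowers_dvd_iff]
  exact forall₂_congr fun h hh => by rw [antipode_pow_even_of_mem_skewPrimitive n hh]

lemma mem_of_sInf_coe_eq {s : Set ℕ} {n : ℕ} (h : sInf ((fun n : ℕ => (n : ℕ∞)) '' s) = n) :
    n ∈ s := by
  have hne : ((fun n : ℕ => (n : ℕ∞)) '' s).Nonempty := by
    rw [Set.nonempty_iff_ne_empty]
    intro h0
    rw [h0, sInf_empty] at h
    exact ENat.natCast_ne_top n h.symm
  obtain ⟨m, hm, hmn⟩ := csInf_mem hne
  rw [h] at hmn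
  exact ENat.natCast_inj.1 hmn ▸ hm

lemma mInvariant_spec {m : ℕ} (hm : mInvariant k H = m) :
    0 < m ∧ ∀ x : GroupLike k H, centralizerIndex x ∣ m :=
  mem_of_sInf_coe_eq hm

lemma mInvariant_le {m : ℕ} (hm : 0 < m) (h : ∀ x : GroupLike k H, centralizerIndex x ∣ m) :
    mInvariant k H ≤ m :=
  sInf_le ⟨m, ⟨hm, h⟩, rfl⟩

lemma mInvariant_le_of_antipode_pow_eq_one {m : ℕ} (hm : 0 < m)
    (h : (antipode k : Module.End k H) ^ (2 * m) = 1) : mInvariant k H ≤ m :=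
  mInvariant_le hm fun x => (centralizerIndex_dvd_iff x m).2 fun c _ => by rw [h]; rfl

lemma antipodeOrder_eq_orderOf {n : ℕ} (hn : 0 < n) (h : (antipode k : Module.End k H) ^ n = 1) :
    antipodeOrder k H = orderOf (antipode k : Module.End k H) := by
  have hpos : 0 < orderOf (antipode k : Module.End k H) :=
    orderOf_pos_iff.2 (isOfFinOrder_iff_pow_eq_one.2 ⟨n, hn, h⟩)
  refine le_antisymm (sInf_le ⟨_, ⟨hpos, pow_orderOf_eq_one _⟩, rfl⟩) (le_sInf ?_)
  rintro _ ⟨j, ⟨hj, hj'⟩, rfl⟩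
  exact Nat.cast_le.2 (orderOf_le_of_pow_eq_one hj hj')

lemma exists_antipode_pow_eq_one (h : antipodeOrder k H ≠ ⊤) :
    ∃ n, 0 < n ∧ (antipode k : Module.End k H) ^ n = 1 := by
  obtain ⟨n, hn⟩ := ENat.ne_top_iff_exists.1 h
  exact ⟨n, mem_of_sInf_coe_eq hn.symm⟩

/-- An odd power of the antipode reverses products, so it can only be the identity if `H` is
commutative. -/
lemma mul_comm_of_antipode_pow_odd {j : ℕ}
    (h : (antipode k : Module.End k H) ^ (2 * j + 1) = 1) (a b : H) : a * b = b * a := by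
  have e : ∀ c : H, ((antipode k : Module.End k H) ^ (2 * j)) (antipode k c) = c := fun c => by
    have := LinearMap.congr_fun h c
    rwa [pow_succ, Module.End.mul_apply] at this
  conv_lhs => rw [← e (a * b), antipode_mul_antidistrib, antipode_pow_even_mul, e, e]

/-- If `S ^ (2 m) = id` with `m = m_H`, then `S = id` or `|S| = 2 m`. An even order `2 j` gives
`m ≤ j`; an odd order forces `H` to be commutative, so that `m = 1` and `S = id`. -/
lemma antipodeOrder_eq_two_mul {m : ℕ} (hm : mInvariant k H = m)
    (h : (antipode k : Module.End k H) ^ (2 * m) = 1) :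
    antipode k = (LinearMap.id : H →ₗ[k] H) ∨ antipodeOrder k H = 2 * mInvariant k H := by
  have hm0 := (mInvariant_spec hm).1
  have hS := pow_orderOf_eq_one (antipode k : Module.End k H)
  have hd := orderOf_dvd_of_pow_eq_one h
  have hpos : 0 < orderOf (antipode k : Module.End k H) :=
    Nat.pos_of_dvd_of_pos hd (by omega)
  rw [antipodeOrder_eq_orderOf (by omega) h, hm]
  rcases Nat.even_or_odd' (orderOf (antipode k : Module.End k H)) with ⟨j, hj | hj⟩
  · rw [hj] at hS hd hpos ⊢
    have h1 := mInvariant_le_of_antipode_pow_eq_one (by omega) hS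
    rw [hm, Nat.cast_le] at h1
    have h2 := Nat.le_of_dvd (by omega) hd
    exact Or.inr (by rw [show j = m by omega]; push_cast; rfl)
  · left
    rw [hj] at hS
    have hcomm := mul_comm_of_antipode_pow_odd hS
    have h1 : mInvariant k H ≤ (1 : ℕ) := mInvariant_le one_pos fun x =>
      (centralizerIndex_dvd_iff x 1).2 fun c hc => by
        rw [antipode_pow_two_apply, antipode_antipode_of_mem_skewPrimitive hc, hcomm (x : H) c,
          mul_assoc, ← GroupLike.val_mul, mul_inv_cancel, GroupLike.val_one, mul_one]
    rw [hm, Nat.cast_le] at h1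
    obtain rfl : m = 1 := by omega
    have h2 : orderOf (antipode k : Module.End k H) = 1 := by
      have := Nat.le_of_dvd (by omega) hd
      omega
    exact orderOf_eq_one_iff.1 h2

end Antipode

/-! ### The antipode and the coradical filtration -/

section Pointed

variable {k H : Type*} [Field k] [Ring H] [HopfAlgebra k H] [IsPointed k H]

lemma antipode_pow_even_of_mem_coradFilt_zero (j : ℕ) {c : H} (hc : c ∈ coradFilt k H 0) :
    ((antipode k : Module.End k H) ^ (2 * j)) c = c := by
  rw [coradFilt_zero_eq] at hc
  exact (Submodule.span_le (p := LinearMap.eqLocus ((antipode k : Module.End k H) ^ (2 * j))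
    LinearMap.id)).2 (fun g hg => antipode_pow_even_groupLike j ⟨g, hg⟩) hc

/-- If all the indices `a_x` divide `m`, then `S ^ (2 m)` is the identity on `H_1`, because
translation by group-like elements carries every skew-primitive element into some `P_{x,1}(H)`. -/
lemma antipode_pow_of_mem_coradFilt_one {m : ℕ}
    (hm : ∀ x : GroupLike k H, centralizerIndex x ∣ m) {c : H} (hc : c ∈ coradFilt k H 1) :
    ((antipode k : Module.End k H) ^ (2 * m)) c = c := by
  refine (coradFilt_one_le (M := LinearMap.eqLocus ((antipode k : Module.End k H) ^ (2 * m))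
    LinearMap.id) (antipode_pow_even_groupLike m) fun g x d hd => ?_) hc
  have h1 : ((g⁻¹ : GroupLike k H) : H) * d ∈ skewPrimitive (g⁻¹ * x) 1 := by
    change comul (((g⁻¹ : GroupLike k H) : H) * d) =
      (((g⁻¹ : GroupLike k H) : H) * d) ⊗ₜ[k] ((g⁻¹ * x : GroupLike k H) : H) +
        ((1 : GroupLike k H) : H) ⊗ₜ[k] (((g⁻¹ : GroupLike k H) : H) * d)
    rw [Bialgebra.comul_mul, (g⁻¹).isGroupLikeElem_val.comul_eq_tmul_self, hd, mul_add,
      Algebra.TensorProduct.tmul_mul_tmul, Algebra.TensorProduct.tmul_mul_tmul,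
      ← GroupLike.val_mul, ← GroupLike.val_mul, inv_mul_cancel]
  have h2 : (g : H) * (((g⁻¹ : GroupLike k H) : H) * d) = d := by
    rw [← mul_assoc, ← GroupLike.val_mul, mul_inv_cancel, GroupLike.val_one, one_mul]
  change ((antipode k : Module.End k H) ^ (2 * m)) d = d
  rw [← h2, antipode_pow_even_mul, antipode_pow_even_groupLike,
    (centralizerIndex_dvd_iff _ m).1 (hm _) _ h1]

lemma antipode_pow_sub_mem_coradFilt {m : ℕ}
    (hm : ∀ x : GroupLike k H, centralizerIndex x ∣ m) (n : ℕ) :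
    ∀ c ∈ coradFilt k H (n + 1),
      ((antipode k : Module.End k H) ^ (2 * m)) c - c ∈ coradFilt k H n :=
  map_sub_mem_coradFilt (comul_antipode_pow_even m)
    (fun _ => antipode_pow_of_mem_coradFilt_one hm) n

lemma antipode_pow_sub_mem_coradFiltPrev {m : ℕ}
    (hm : ∀ x : GroupLike k H, centralizerIndex x ∣ m) (n : ℕ) :
    ∀ c ∈ coradFilt k H n,
      ((antipode k : Module.End k H) ^ (2 * m)) c - c ∈ coradFiltPrev k H n := by
  cases n with
  | zero =>
    intro c hc
    rw [antipode_pow_even_of_mem_coradFilt_zero m hc, sub_self]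
    exact zero_mem _
  | succ n => exact antipode_pow_sub_mem_coradFilt hm n

end Pointed

/-! ### Characteristic zero and the associated graded Hopf algebra -/

section CharZero

/-- In characteristic zero, if `T c = c + d` with `T d = d`, then `T ^ N c = c + N d`, so `d = 0`
whenever some positive power of `T` fixes `c`. -/
lemma apply_eq_of_apply_sub_eq {k M : Type*} [Field k] [CharZero k] [AddCommGroup M] [Module k M]
    {T : Module.End k M} {c : M} (hT : T (T c - c) = T c - c) {N : ℕ} (hN : 0 < N)
    (h : (T ^ N) c = c) : T c = c := by
  have e : ∀ n : ℕ, (T ^ n) c = c + (n : k) • (T c - c) := fun n => by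
    induction n with
    | zero => simp
    | succ n ih =>
      rw [pow_succ', Module.End.mul_apply, ih, map_add, map_smul, hT, Nat.cast_add, Nat.cast_one,
        add_smul, one_smul]
      abel
  rw [e, add_eq_left, smul_eq_zero] at h
  exact sub_eq_zero.1 (h.resolve_left (Nat.cast_ne_zero.2 hN.ne'))

/-- In characteristic zero, an operator of finite order on a pointed coalgebra that induces the
identity on the quotients `C_n / C_{n-1}` is the identity. -/
lemma eq_one_of_sub_mem_coradFiltPrev {k C : Type*} [Field k] [CharZero k] [AddCommGroup C]
    [Module k C] [Coalgebra k C] [IsPointed k C] {T : Module.End k C}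
    (hT : ∀ n, ∀ c ∈ coradFilt k C n, T c - c ∈ coradFiltPrev k C n) {N : ℕ} (hN : 0 < N)
    (h : T ^ N = 1) : T = 1 := by
  have key : ∀ n, ∀ c ∈ coradFilt k C n, T c = c := fun n => by
    induction n with
    | zero => exact fun c hc => sub_eq_zero.1 ((Submodule.mem_bot k).1 (hT 0 c hc))
    | succ n ih => exact fun c hc =>
        apply_eq_of_apply_sub_eq (ih _ (hT (n + 1) c hc)) hN (by rw [h]; rfl)
  refine LinearMap.ext fun c => ?_
  obtain ⟨n, hn⟩ := exists_mem_coradFilt (k := k) c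
  exact key n c hn

variable {k H : Type*} [Field k] [Ring H] [HopfAlgebra k H] [IsPointed k H]

lemma mem_coradFiltPrev_of_symbol_eq_zero {n : ℕ} {c : H} (hc : c ∈ coradFilt k H n)
    (h : symbol k H n c = 0) : c ∈ coradFiltPrev k H n := by
  rw [← lof_grMk n ⟨c, hc⟩] at h
  exact grMk_eq_zero.1 (DirectSum.of_injective n (h.trans (map_zero _).symm))

/-- The group-like element of `gr H` given by the class of a group-like element of `H`. -/
def grGroupLike (x : GroupLike k H) : GroupLike k (Gr k H) where
  val := symbol k H 0 x
  isGroupLikeElem_val := by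
    have hx : (x : H) ∈ coradFilt k H 0 := by
      rw [coradFilt_zero_eq]; exact Submodule.subset_span x.isGroupLikeElem_val
    refine ⟨?_, ?_⟩
    · change grCounit k H (symbol k H 0 x) = 1
      rw [grCounit_symbol_zero hx, x.isGroupLikeElem_val.counit_eq_one]
    · change grComul k H (symbol k H 0 x) = _
      rw [grComul_symbol hx, x.isGroupLikeElem_val.comul_eq_tmul_self]
      exact symbolTensor_tmul hx hx

lemma mem_coradFilt_one_of_mem_skewPrimitive {x : GroupLike k H} {h : H}
    (hh : h ∈ skewPrimitive x 1) : h ∈ coradFilt k H 1 := by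
  have hG : ∀ g : GroupLike k H, (g : H) ∈ coradFilt k H 0 := fun g => by
    rw [coradFilt_zero_eq]; exact Submodule.subset_span g.isGroupLikeElem_val
  rw [mem_coradFilt_succ,
    show comul h = h ⊗ₜ[k] (x : H) + ((1 : GroupLike k H) : H) ⊗ₜ[k] h from hh]
  exact Submodule.add_mem_sup (tmul_mem_tensorSub Submodule.mem_top (hG x))
    (tmul_mem_tensorSub (hG 1) Submodule.mem_top)

lemma symbol_mem_skewPrimitive {x : GroupLike k H} {h : H} (hh : h ∈ skewPrimitive x 1) :
    symbol k H 1 h ∈ skewPrimitive (grGroupLike x) 1 := by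
  have hx : (x : H) ∈ coradFilt k H 0 := by
    rw [coradFilt_zero_eq]; exact Submodule.subset_span x.isGroupLikeElem_val
  have h1 := mem_coradFilt_one_of_mem_skewPrimitive hh
  change grComul k H (symbol k H 1 h) = symbol k H 1 h ⊗ₜ[k] symbol k H 0 x +
    (1 : Gr k H) ⊗ₜ[k] symbol k H 1 h
  rw [grComul_symbol h1,
    show comul h = h ⊗ₜ[k] (x : H) + ((1 : GroupLike k H) : H) ⊗ₜ[k] h from hh, map_add,
    one_eq_symbol, GroupLike.val_one]
  exact congrArg₂ _ (symbolTensor_tmul h1 hx) (symbolTensor_tmul one_mem_coradFilt h1)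

lemma antipode_pow_mem_coradFilt (j : ℕ) {n : ℕ} {c : H} (hc : c ∈ coradFilt k H n) :
    ((antipode k : Module.End k H) ^ j) c ∈ coradFilt k H n := by
  induction j with
  | zero => exact hc
  | succ j ih =>
    rw [pow_succ', Module.End.mul_apply]
    exact antipode_mem_coradFilt ih

lemma antipode_pow_symbol (j : ℕ) {n : ℕ} {c : H} (hc : c ∈ coradFilt k H n) :
    ((antipode k : Module.End k (Gr k H)) ^ j) (symbol k H n c) =
      symbol k H n (((antipode k : Module.End k H) ^ j) c) := by
  induction j with
  | zero => rfl
  | succ j ih =>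
    rw [pow_succ', Module.End.mul_apply, ih, pow_succ', Module.End.mul_apply]
    exact grAntipode_symbol (antipode_pow_mem_coradFilt j hc)

/-- A power of the antipode of `gr H` is the identity if and only if the same power of `S` induces
the identity on the quotients `H_n / H_{n-1}`. -/
lemma antipode_pow_gr_eq_one_iff {j : ℕ} : (antipode k : Module.End k (Gr k H)) ^ j = 1 ↔
    ∀ n, ∀ c ∈ coradFilt k H n,
      ((antipode k : Module.End k H) ^ j) c - c ∈ coradFiltPrev k H n := by
  constructor
  · intro h n c hc
    refine mem_coradFiltPrev_of_symbol_eq_zero (sub_mem (antipode_pow_mem_coradFilt j hc) hc) ?_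
    rw [map_sub, ← antipode_pow_symbol j hc, h, Module.End.one_apply, sub_self]
  · intro h
    refine gr_ext fun n c hc => ?_
    rw [antipode_pow_symbol j hc, Module.End.one_apply, ← sub_eq_zero, ← map_sub]
    exact symbol_eq_zero (h n c hc)

/-- In characteristic zero, if some power of `x` centralizes `P_{x,1}(H)`, then the index `a_x`
divides the corresponding index for the class of `x` in `gr H`: if `S ^ (2 n)` fixes the classes of
the elements of `P_{x,1}(H)` in `H_1 / H_0`, then it is unipotent and of finite order on
`P_{x,1}(H)`, hence the identity. -/
lemma centralizerIndex_dvd_of_gr [CharZero k] {m : ℕ} (hm0 : 0 < m) {x : GroupLike k H}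
    (hm : centralizerIndex x ∣ m) {n : ℕ} (hn : centralizerIndex (grGroupLike x) ∣ n) :
    centralizerIndex x ∣ n := by
  rw [centralizerIndex_dvd_iff] at hm hn ⊢
  intro h hh
  have h1 := mem_coradFilt_one_of_mem_skewPrimitive hh
  have h2 := hn _ (symbol_mem_skewPrimitive hh)
  rw [antipode_pow_symbol _ h1, ← sub_eq_zero, ← map_sub] at h2
  refine apply_eq_of_apply_sub_eq (antipode_pow_even_of_mem_coradFilt_zero n
    (mem_coradFiltPrev_of_symbol_eq_zero (sub_mem (antipode_pow_mem_coradFilt _ h1) h1) h2)) hm0 ?_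
  have h3 : ∀ i, (((antipode k : Module.End k H) ^ (2 * m)) ^ i) h = h := fun i => by
    induction i with
    | zero => rfl
    | succ i ih => rw [pow_succ, Module.End.mul_apply, hm h hh, ih]
  rw [← pow_mul, show 2 * n * m = 2 * m * n by ring, pow_mul, h3]

lemma antipodeOrder_of_charZero [CharZero k] (h : antipodeOrder k H ≠ ⊤) :
    antipode k = (LinearMap.id : H →ₗ[k] H) ∨
      (antipodeOrder k H = 2 * mInvariant k H ∧
        2 * mInvariant k H = 2 * mInvariant k (Gr k H) ∧
        2 * mInvariant k (Gr k H) = antipodeOrder k (Gr k H)) := by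
  obtain ⟨N, hN, hSN⟩ := exists_antipode_pow_eq_one h
  have hle : mInvariant k H ≤ N :=
    mInvariant_le_of_antipode_pow_eq_one hN (by rw [mul_comm, pow_mul, hSN, one_pow])
  obtain ⟨m, hm⟩ := ENat.ne_top_iff_exists.1 (ne_top_of_le_ne_top (ENat.natCast_ne_top N) hle)
  obtain ⟨hm0, hdvd⟩ := mInvariant_spec hm.symm
  have hS : (antipode k : Module.End k H) ^ (2 * m) = 1 :=
    eq_one_of_sub_mem_coradFiltPrev (antipode_pow_sub_mem_coradFiltPrev hdvd) hN
      (by rw [← pow_mul, mul_comm, pow_mul, hSN, one_pow])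
  have hgr : (antipode k : Module.End k (Gr k H)) ^ (2 * m) = 1 :=
    antipode_pow_gr_eq_one_iff.2 (antipode_pow_sub_mem_coradFiltPrev hdvd)
  have hmgr : mInvariant k (Gr k H) = m := by
    refine le_antisymm (mInvariant_le_of_antipode_pow_eq_one hm0 hgr) (le_sInf ?_)
    rintro _ ⟨n, ⟨hn, hn'⟩, rfl⟩
    rw [hm]
    exact mInvariant_le hn fun x => centralizerIndex_dvd_of_gr hm0 (hdvd x) (hn' _)
  rcases antipodeOrder_eq_two_mul hmgr hgr with h1 | h1
  · -- If the antipode of `gr H` is the identity, then `S` is unipotent of finite order.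
    refine Or.inl (eq_one_of_sub_mem_coradFiltPrev (T := (antipode k : Module.End k H)) ?_ hN hSN)
    have h2 := (antipode_pow_gr_eq_one_iff (k := k) (H := H) (j := 1)).1
      (by rw [pow_one]; exact h1)
    simpa only [pow_one] using h2
  · exact (antipodeOrder_eq_two_mul hm.symm hS).imp_right fun h2 =>
      ⟨h2, by rw [hmgr, hm], h1.symm⟩

end CharZero

/-! ### Positive characteristic -/

section CharP

variable {k H : Type*} [Field k] [Ring H] [HopfAlgebra k H] [IsPointed k H]

lemma sub_one_pow_apply_eq_zero {m : ℕ} (hm : ∀ x : GroupLike k H, centralizerIndex x ∣ m)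
    (n : ℕ) : ∀ c ∈ coradFilt k H (n + 1),
      (((antipode k : Module.End k H) ^ (2 * m) - 1) ^ (n + 1)) c = 0 := by
  induction n with
  | zero =>
    intro c hc
    rw [zero_add, pow_one, LinearMap.sub_apply, antipode_pow_of_mem_coradFilt_one hm hc,
      Module.End.one_apply, sub_self]
  | succ n ih =>
    intro c hc
    rw [pow_succ, Module.End.mul_apply, LinearMap.sub_apply, Module.End.one_apply]
    exact ih _ (antipode_pow_sub_mem_coradFilt hm (n + 1) c hc)

/-- In characteristic `p`, the operator `S ^ (2 m) - 1` is nilpotent of order at most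
`max n 1` on `H_n`, so its power `S ^ (2 m p ^ l) - 1` with exponent `p ^ l ≥ n` vanishes on the
generators. -/
lemma antipode_pow_eq_one_of_charP {p : ℕ} (hp : p.Prime) [CharP k p] {m : ℕ}
    (hm : ∀ x : GroupLike k H, centralizerIndex x ∣ m) {n : ℕ}
    (hn : Algebra.adjoin k (coradFilt k H n : Set H) = ⊤) {l : ℕ} (hl : n ≤ p ^ l) :
    (antipode k : Module.End k H) ^ (2 * (m * p ^ l)) = 1 := by
  have : Nontrivial H := ⟨1, 0, IsGroupLikeElem.one (R := k).ne_zero⟩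
  have : Fact p.Prime := ⟨hp⟩
  have : CharP (Module.End k H) p := charP_of_injective_algebraMap (R := k)
    (FaithfulSMul.algebraMap_injective k (Module.End k H)) p
  have hgen : ∀ c ∈ coradFilt k H n,
      ((antipode k : Module.End k H) ^ (2 * (m * p ^ l))) c = c := fun c hc => by
    obtain ⟨q, hq⟩ := Nat.exists_eq_succ_of_ne_zero (pow_pos hp.pos l).ne'
    have h1 := sub_one_pow_apply_eq_zero hm q c (coradFilt_mono k H (hl.trans_eq hq) hc)
    rw [← Nat.succ_eq_add_one, ← hq, sub_pow_char_pow_of_commute _ _ (Commute.one_right _), one_pow,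
      ← pow_mul, LinearMap.sub_apply, Module.End.one_apply, sub_eq_zero, mul_assoc] at h1
    exact h1
  refine LinearMap.ext fun c => ?_
  have hc : c ∈ Algebra.adjoin k (coradFilt k H n : Set H) := hn ▸ Algebra.mem_top
  rw [Module.End.one_apply]
  induction hc using Algebra.adjoin_induction with
  | mem c hc => exact hgen c hc
  | algebraMap r =>
    rw [Algebra.algebraMap_eq_smul_one, map_smul, ← GroupLike.val_one (R := k),
      antipode_pow_even_groupLike]
  | add a b _ _ ha hb => rw [map_add, ha, hb]
  | mul a b _ _ ha hb => rw [antipode_pow_even_mul, ha, hb]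

end CharP

end PointedHopf

end

open PointedHopf
theorem theorem1p1 {k : Type*} {H : Type*} [Field k] [Ring H] [HopfAlgebra k H]
    [IsPointed k H] :
    (mInvariant k H = ⊤ → antipodeOrder k H = ⊤) ∧
    (∀ m : ℕ, mInvariant k H = m → ∀ n : ℕ, 1 ≤ n → ∀ h ∈ coradFilt k H n,
      ((HopfAlgebra.antipode k : Module.End k H) ^ (2 * m)) h - h ∈ coradFilt k H (n - 1)) ∧
    (CharZero k → antipodeOrder k H ≠ ⊤ →
      HopfAlgebra.antipode k = (LinearMap.id : H →ₗ[k] H) ∨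
      (antipodeOrder k H = 2 * mInvariant k H ∧
        2 * mInvariant k H = 2 * mInvariant k (Gr k H) ∧
        2 * mInvariant k (Gr k H) = antipodeOrder k (Gr k H))) ∧
    (∀ p : ℕ, p.Prime → CharP k p → ∀ m : ℕ, mInvariant k H = m →
      ∀ n : ℕ, Algebra.adjoin k (coradFilt k H n : Set H) = ⊤ →
      ∀ l : ℕ, n ≤ p ^ l → ∃ d : ℕ, antipodeOrder k H = d ∧ d ∣ 2 * m * p ^ l) := by
  refine ⟨fun h => ?_, fun m hm n hn c hc => ?_, fun _ => antipodeOrder_of_charZero,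
    fun p hp _ m hm n hn l hl => ?_⟩
  · by_contra hS
    obtain ⟨N, hN, hSN⟩ := exists_antipode_pow_eq_one hS
    exact (mInvariant_le_of_antipode_pow_eq_one hN
      (by rw [mul_comm, pow_mul, hSN, one_pow])).not_gt (h ▸ ENat.natCast_lt_top N)
  · obtain ⟨n, rfl⟩ := Nat.exists_eq_succ_of_ne_zero (Nat.one_le_iff_ne_zero.1 hn)
    exact antipode_pow_sub_mem_coradFilt (mInvariant_spec hm).2 n c hc
  · have h1 := antipode_pow_eq_one_of_charP hp (mInvariant_spec hm).2 hn hl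
    rw [← mul_assoc] at h1
    have hpos := Nat.mul_pos (Nat.mul_pos two_pos (mInvariant_spec hm).1) (pow_pos hp.pos l)
    exact ⟨_, antipodeOrder_eq_orderOf hpos h1, orderOf_dvd_of_pow_eq_one h1⟩
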